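/- Let $n\ge 0$ and let $s_0,s_1,\dots,s_{2n+1}$ be real numbers such that the Hankel matrix $S_n=(s_{i+j})_{i,j=0}^n$ is positive definite. Let $\mathfrak S$ be the linear functional on polynomials of degree at most $2n+1$ with $\mathfrak S(t^j)=s_j$. Let $P_0,\dots,P_n$ be the real polynomials with $\deg P_k=k$, positive leading coefficients and $\mathfrak S(P_jP_k)=\delta_{jk}$ for $j,k\le n$; let $P_{n+1}$ be any real polynomial of degree $n+1$ with positive leading coefficient such that $\mathfrak S(P_jP_{n+1})=0$ for $j\le n$ (such polynomials exist, and $P_{n+1}$ is unique up to a positive factor). Let $Q_k(\lambda)=\mathfrak S\left(\frac{P_k(t)-P_k(\lambda)}{t-\lambda}\right)$, with $\mathfrak S$ acting in the variable $t$. $\mathbf N_0$ is the class of functions $f$ holomorphic on $\mathbb C\setminus\mathbb R$ with $f(\bar\lambda)=\overline{f(\lambda)}$ and $\operatorname{Im} f(\lambda)\ge 0$ for $\operatorname{Im}\lambda>0$. Write $\lambda\,\widehat{\to}\,\infty$ for $\lambda\to\infty$ nontangentially, i.e. within each sector $\delta<\arg\lambda<\pi-\delta$, $\delta>0$. $\mathbf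 N_{0,1}$ is the class of $f\in\mathbf N_0$ such that $f(\lambda)=o(\lambda)$ as $\lambda\,\widehat{\to}\,\infty$ and $\int_\eta^\infty \frac{|\operatorname{Im} f(iy)|}{y}\,dy<\infty$ for some $\eta>0$. A function $\tau$ satisfies (O) if $\tau(\lambda)=o(1)$ as $\lambda\,\widehat{\to}\,\infty$. Then the truncated Hamburger moment problem of finding a positive Borel measure $\mu$ on $\mathbb R$ such that $$\int_{\mathbb R}t^j\,d\mu(t)=s_j,\qquad j=0,1,\dots,2n+1$$ (absolutely convergent integrals), is solvable. For $\tau\in\mathbf N_0$ the function $P_n\tau+P_{n+1}$ has no zeros in $\mathbb C\setminus\mathbb R$, and the formula $$\varphi(\lambda)=-\frac{Q_n(\lambda)\tau(\lambda)+Q_{n+1}(\lambda)}{P_n(\lambda)\tau(\lambda)+P_{n+1}(\lambda)},\qquad \lambda\in\mathbb C\setminus\mathbb R,$$ which determines $\tau$ uniquely from $\varphi$, describes the solutions as follows. 1. A finite positive Borel measure $\mu$ on $\mathbb R$ solves the moment problem if and only if $\varphi(\lambda)=\int_{\mathbb R}\frac{d\mu(t)}{t-\lambda}$ is given by the formula with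 some $\tau\in\mathbf N_{0,1}$ satisfying (O); and every $\tau\in\mathbf N_{0,1}$ satisfying (O) arises in this way from a solution $\mu$. 2. A function $\varphi$ on $\mathbb C\setminus\mathbb R$ solves the interpolation problem $IP_0$, that is, $\varphi\in\mathbf N_0$ and $$\varphi(\lambda)=-\frac{s_0}{\lambda}-\dots-\frac{s_{2n+1}}{\lambda^{2n+2}}+o\left(\frac1{\lambda^{2n+2}}\right),\qquad \lambda\,\widehat{\to}\,\infty,$$ if and only if it is given by the formula with some $\tau\in\mathbf N_0$ satisfying (O). -/

import Mathlib

open Filter Asymptotics MeasureTheory Polynomial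

noncomputable section

namespace TruncatedHamburger

/-- The Hankel matrix `S_n = (s_{i+j})_{i,j=0}^n`. -/
def hankel (s : ℕ → ℝ) (n : ℕ) : Matrix (Fin (n + 1)) (Fin (n + 1)) ℝ :=
  Matrix.of fun i j => s (i + j)

/-- `μ` solves the truncated Hamburger moment problem for `s_0, …, s_ℓ`: the moments up to
order `ℓ` exist (as absolutely convergent integrals) and equal the given numbers. -/
def IsMomentSolution (s : ℕ → ℝ) (l : ℕ) (μ : Measure ℝ) : Prop :=
  ∀ j ≤ l, Integrable (fun t : ℝ => t ^ j) μ ∧ ∫ t, t ^ j ∂μ = s j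

/-- The function `φ(z) = ∫ dμ(t) / (t - z)` associated with a measure `μ` on the line. -/
def stieltjes (μ : Measure ℝ) (z : ℂ) : ℂ := ∫ t : ℝ, 1 / ((t : ℂ) - z) ∂μ

/-- The filter "`z → ∞` in the sector `δ < arg z < π - δ`". -/
def sectorAtInfty (δ : ℝ) : Filter ℂ :=
  Bornology.cobounded ℂ ⊓ 𝓟 {z : ℂ | δ < z.arg ∧ z.arg < Real.pi - δ}

/-- `f(z) = o(g(z))` as `z → ∞` nontangentially, that is, in every sector
`δ < arg z < π - δ` with `δ > 0`. -/
def NTLittleO (f g : ℂ → ℂ) : Prop :=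
  ∀ δ : ℝ, 0 < δ → f =o[sectorAtInfty δ] g

/-- Nevanlinna functions, the class `N_0`. Only the values off the real line matter. -/
structure IsNevanlinna (f : ℂ → ℂ) : Prop where
  holo : DifferentiableOn ℂ f {z : ℂ | z.im ≠ 0}
  symm : ∀ z : ℂ, z.im ≠ 0 → f (starRingEnd ℂ z) = starRingEnd ℂ (f z)
  im_nonneg : ∀ z : ℂ, 0 < z.im → 0 ≤ (f z).im

/-- The subclass `N_{0,1}`: Nevanlinna functions `f` with `f(z) = o(z)` nontangentially at
`∞` and `∫_η^∞ |Im f(iy)| / y dy < ∞` for some `η > 0`. -/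
structure IsNevanlinnaOne (f : ℂ → ℂ) : Prop where
  nevanlinna : IsNevanlinna f
  little_o : NTLittleO f fun z => z
  integrable : ∃ η : ℝ, 0 < η ∧
    IntegrableOn (fun y : ℝ => |(f (Complex.I * y)).im| / y) (Set.Ioi η)

/-- The condition (O): `τ(z) = o(1)` as `z → ∞` nontangentially. -/
def CondO (τ : ℂ → ℂ) : Prop := NTLittleO τ fun _ => 1

/-- `φ` solves the interpolation problem `IP_0(s, ℓ)`: it is a Nevanlinna function with
`φ(z) = -s_0/z - ⋯ - s_ℓ/z^{ℓ+1} + o(1/z^{ℓ+1})` as `z → ∞` nontangentially. -/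
structure IsInterpolationSolution (s : ℕ → ℝ) (l : ℕ) (φ : ℂ → ℂ) : Prop where
  nevanlinna : IsNevanlinna φ
  expansion : NTLittleO
    (fun z => φ z - ∑ j ∈ Finset.range (l + 1), -((s j : ℂ) / z ^ (j + 1)))
    (fun z => 1 / z ^ (l + 1))

/-- The linear functional on `ℂ[t]` with `t^j ↦ s_j`. -/
def momentFunctional (s : ℕ → ℝ) (p : ℂ[X]) : ℂ := p.sum fun j a => a * (s j : ℂ)

/-- `P_0, …, P_n` are the polynomials orthonormal with respect to the moment functional, with
positive leading coefficients, and `P_{n+1}` is of degree `n + 1`, with positive leading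
coefficient, and orthogonal to `P_0, …, P_n`. The norm of `P_{n+1}` would involve the moment
`s_{2n+2}`, which is not given, so the positive factor in `P_{n+1}` is left free. Only
`s_0, …, s_{2n+1}` enter. -/
structure IsFirstKind (s : ℕ → ℝ) (n : ℕ) (P : ℕ → ℝ[X]) : Prop where
  natDegree_eq : ∀ k ≤ n + 1, (P k).natDegree = k
  leadingCoeff_pos : ∀ k ≤ n + 1, 0 < (P k).leadingCoeff
  orthonormal : ∀ j ≤ n, ∀ k ≤ n,
    momentFunctional s ((P j * P k).map (algebraMap ℝ ℂ)) = if j = k then 1 else 0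
  orthogonal : ∀ j ≤ n, momentFunctional s ((P j * P (n + 1)).map (algebraMap ℝ ℂ)) = 0

/-- The value `P(z)` of a real polynomial at a complex number. -/
def firstKind (P : ℝ[X]) (z : ℂ) : ℂ := (P.map (algebraMap ℝ ℂ)).eval z

/-- The polynomial of the second kind `Q(z)`: the moment functional applied, in the variable
`t`, to the polynomial `(P(t) - P(z)) / (t - z)`. -/
def secondKind (s : ℕ → ℝ) (P : ℝ[X]) (z : ℂ) : ℂ :=
  momentFunctional s ((P.map (algebraMap ℝ ℂ) - C (firstKind P z)) /ₘ (X - C z))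

/-- The denominator `P_n(z) τ(z) + P_{n+1}(z)` of the Nevanlinna formula. -/
def nevDenom (P : ℕ → ℝ[X]) (n : ℕ) (τ : ℂ → ℂ) (z : ℂ) : ℂ :=
  firstKind (P n) z * τ z + firstKind (P (n + 1)) z

/-- The Nevanlinna formula `-(Q_n τ + Q_{n+1}) / (P_n τ + P_{n+1})`. -/
def nevFormula (s : ℕ → ℝ) (P : ℕ → ℝ[X]) (n : ℕ) (τ : ℂ → ℂ) (z : ℂ) : ℂ :=
  -((secondKind s (P n) z * τ z + secondKind s (P (n + 1)) z) / nevDenom P n τ z)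

end TruncatedHamburger

end

/-! Put c_k(z) = P_k(z) φ(z) + Q_k(z), which is `recSol` with α = φ(z), β = 1. The Nevanlinna
formula is the linear relation c_n τ + c_{n+1} = 0 (`eq_nevFormula_iff`). The c_k satisfy the
three-term recurrence of the P_k, and Christoffel–Darboux at z and its conjugate gives
(`mul_im_eq`), with b_n > 0 the last off-diagonal Jacobi entry, b_n |c_n|² Im τ = Im φ - Im z ·
Σ_{k≤n} |c_k|². If τ is a Nevanlinna function, so is φ. Conversely, if φ is the Stieltjes transform
of a measure with the moments up to order 2n, the c_k are the Fourier coefficients of 1/(t - z) in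
the orthonormal system P_k, and Bessel's inequality gives Im τ ≥ 0.

The behaviour at ∞ is read from the scaled remainder R(z) = z^{2n+2} (φ + s_0/z + ⋯ +
s_{2n+1}/z^{2n+2}). It is a fractional linear function of τ whose coefficients have limits at ∞, so
R → 0 exactly when τ → 0 (`tendsto_scaledRemainder`, `tendsto_parameter`). Every solution of the
interpolation problem is a Stieltjes transform, by the Herglotz representation
(`IsInterpolationSolution.exists_stieltjes`), and its measure has the moments up to order 2n, by
Fatou's lemma (`isMomentSolution_of_tendsto`). This settles the interpolation problem.

The moment of order 2n+1 need not exist as an absolutely convergent integral. On the imaginary axis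
Im R(iy) / y = ∫ t^{2n+2} / (t² + y²) dμ(t), and by Tonelli this is integrable in y near ∞ exactly
when |t|^{2n+1} is μ-integrable. Since R = Cτ + O(1/z) with a constant C > 0, this is the integral
condition in the class N_{0,1} (`kac_iff`). Solvability follows by taking τ = 0. -/

namespace TruncatedHamburger

/-! ### Poisson representation of positive harmonic functions on the disc. -/

open Metric in
/-- A function that is holomorphic in the unit disc and continuous up to the boundary, with
nonnegative imaginary part: its imaginary part is the Poisson integral of a measure. -/
theorem exists_poissonIntegral_of_diffContOnCl {F : ℂ → ℂ} (hF : DiffContOnCl ℂ F (ball 0 1))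
    (hpos : ∀ w ∈ closedBall (0 : ℂ) 1, 0 ≤ (F w).im) :
    ∃ ν : Measure (sphere (0 : ℂ) 1), IsFiniteMeasure ν ∧
      ∀ w ∈ ball (0 : ℂ) 1, (F w).im = ∫ ζ, poissonKernel 0 w (ζ : ℂ) ∂ν := by
  have hcont : ContinuousOn F (closedBall 0 1) := by
    have := hF.continuousOn
    rwa [closure_ball (0 : ℂ) one_ne_zero] at this
  let e : ℝ → sphere (0 : ℂ) 1 := fun θ => ⟨circleMap 0 1 θ, by simp [circleMap]⟩
  have he : Continuous e := Continuous.subtype_mk (continuous_circleMap 0 1) _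
  let u : ℝ → ℝ := fun θ => (F (circleMap 0 1 θ)).im
  have hmem : ∀ θ, circleMap 0 1 θ ∈ closedBall (0 : ℂ) 1 := fun θ =>
    circleMap_mem_closedBall 0 zero_le_one θ
  have hu : Continuous u :=
    Complex.continuous_im.comp (hcont.comp_continuous (continuous_circleMap 0 1) hmem)
  have hu0 : ∀ θ, 0 ≤ u θ := fun θ => hpos _ (hmem θ)
  -- The measure is Im F dθ/2π, defined on (0, 2π] and pushed forward to the circle.
  let ρ : ℝ → NNReal := fun θ => Real.toNNReal ((2 * Real.pi)⁻¹ * u θ)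
  have hρ : Continuous ρ := by fun_prop
  let ν₀ : Measure ℝ := (volume.restrict (Set.Ioc 0 (2 * Real.pi))).withDensity fun θ => ρ θ
  have hfin : IsFiniteMeasure ν₀ := by
    refine isFiniteMeasure_withDensity ?_
    have : IntegrableOn (fun θ => (2 * Real.pi)⁻¹ * u θ) (Set.Ioc 0 (2 * Real.pi)) :=
      (Continuous.integrableOn_Icc (by fun_prop)).mono_set Set.Ioc_subset_Icc_self
    exact this.lintegral_lt_top.ne
  refine ⟨ν₀.map e, inferInstance, fun w hw => ?_⟩
  have hK : ContinuousOn (fun z => poissonKernel 0 w z) (sphere 0 1) := by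
    have h : ∀ z ∈ sphere (0 : ℂ) 1, ‖z - 0 - (w - 0)‖ ^ 2 ≠ 0 := by
      intro z hz h0
      have : z = w := by simpa [sub_eq_zero] using h0
      simp_all
    unfold poissonKernel
    fun_prop (disch := assumption)
  have hKc : Continuous fun ζ : sphere (0 : ℂ) 1 => poissonKernel 0 w (ζ : ℂ) :=
    continuousOn_iff_continuous_domRestrict.1 hK
  rw [integral_map he.aemeasurable hKc.aestronglyMeasurable]
  rw [integral_withDensity_eq_integral_smul hρ.measurable]
  have h1 := hF.circleAverage_poissonKernel_smul hw
  have hint : CircleIntegrable (poissonKernel 0 w • F) 0 1 := by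
    refine ContinuousOn.circleIntegrable zero_le_one ?_
    exact hK.smul (hcont.mono sphere_subset_closedBall)
  have h2 := Complex.imCLM.circleAverage_comp_comm hint
  rw [h1] at h2
  have h3 : (F w).im = Complex.imCLM (F w) := rfl
  rw [h3, ← h2, Real.circleAverage_def, intervalIntegral.integral_of_le (by positivity),
    ← integral_smul]
  refine integral_congr_ae (ae_of_all _ fun θ => ?_)
  have : 0 ≤ (2 * Real.pi)⁻¹ * u θ := mul_nonneg (by positivity) (hu0 θ)
  simp only [NNReal.smul_def, ρ, Real.coe_toNNReal _ this, e]
  simp [u]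
  ring

open Metric in
/-- The imaginary part of a holomorphic function on the unit disc, when it is nonnegative, is the
Poisson integral of a measure on the circle. -/
theorem exists_poissonIntegral {F : ℂ → ℂ} (hF : DifferentiableOn ℂ F (ball 0 1))
    (hpos : ∀ w ∈ ball (0 : ℂ) 1, 0 ≤ (F w).im) :
    ∃ ν : Measure (sphere (0 : ℂ) 1), IsFiniteMeasure ν ∧
      ∀ w ∈ ball (0 : ℂ) 1, (F w).im = ∫ ζ, poissonKernel 0 w (ζ : ℂ) ∂ν := by
  have hmaps : ∀ r : ℝ, 0 < r → r < 1 → ∀ w ∈ closedBall (0 : ℂ) 1, (r : ℂ) * w ∈ ball (0 : ℂ) 1 := by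
    intro r h0 h1 w hw
    rw [mem_closedBall_zero_iff] at hw
    rw [mem_ball_zero_iff, norm_mul, Complex.norm_real, Real.norm_of_nonneg h0.le]
    nlinarith
  have hex : ∀ r : ℝ, ∃ ν : FiniteMeasure (sphere (0 : ℂ) 1), 0 < r → r < 1 →
      ∀ w ∈ ball (0 : ℂ) 1, (F (r * w)).im = ∫ ζ : sphere (0 : ℂ) 1, poissonKernel 0 w (ζ : ℂ) ∂(ν : Measure (sphere (0 : ℂ) 1)) := by
    intro r
    by_cases hr : 0 < r ∧ r < 1
    · have hd : DifferentiableOn ℂ (fun w => F (r * w)) (closedBall 0 1) :=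
        hF.comp (by fun_prop) (fun w hw => hmaps r hr.1 hr.2 w hw)
      have hcl : DiffContOnCl ℂ (fun w => F (r * w)) (ball 0 1) := by
        refine DifferentiableOn.diffContOnCl ?_
        rwa [closure_ball (0 : ℂ) one_ne_zero]
      obtain ⟨ν, hν, h⟩ := exists_poissonIntegral_of_diffContOnCl hcl
        (fun w hw => hpos _ (hmaps r hr.1 hr.2 w hw))
      exact ⟨⟨ν, hν⟩, fun _ _ => h⟩
    · exact ⟨0, fun h0 h1 => absurd ⟨h0, h1⟩ hr⟩
  choose ν hν using hex
  -- The kernel is 1 at the centre of the disc, so every dilation F(r ·) gives a measure of mass Im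
  -- F(0). This bound, uniform in r, provides weak compactness.
  have hmass : ∀ r : ℝ, 0 < r → r < 1 → (ν r).mass ≤ Real.toNNReal (F 0).im := by
    intro r h0 h1
    have h := hν r h0 h1 0 (by simp)
    have h' : ∀ ζ : sphere (0 : ℂ) 1, poissonKernel 0 0 (ζ : ℂ) = 1 := by
      intro ζ
      have : ‖(ζ : ℂ)‖ = 1 := by simp
      simp [poissonKernel]
    simp only [h', mul_zero] at h
    rw [h]
    rw [integral_const, smul_eq_mul, mul_one]
    refine le_of_eq (NNReal.coe_injective ?_)
    rw [Real.coe_toNNReal _ measureReal_nonneg]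
    rfl
  -- An ultrafilter finer than r → 1⁻ plays the role of a convergent subsequence.
  let U : Ultrafilter ℝ := Ultrafilter.of (nhdsWithin 1 (Set.Iio 1))
  have hU : (U : Filter ℝ) ≤ nhdsWithin 1 (Set.Iio 1) := Ultrafilter.of_le _
  have hU01 : ∀ᶠ r in (U : Filter ℝ), 0 < r ∧ r < 1 := by
    refine hU ?_
    have : Set.Ioo (0 : ℝ) 1 ∈ nhdsWithin 1 (Set.Iio 1) := Ioo_mem_nhdsLT one_pos
    exact this
  obtain ⟨ν', -, hlim⟩ := (isCompact_setOfPred_finiteMeasure_le_of_compactSpace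
    (sphere (0 : ℂ) 1) (Real.toNNReal (F 0).im)).ultrafilter_le_nhds (U.map ν) (by
      refine tendsto_principal.2 ?_
      filter_upwards [hU01] with r hr using hmass r hr.1 hr.2)
  have hlim' : Tendsto ν U (nhds ν') := hlim
  refine ⟨ν', inferInstance, fun w hw => ?_⟩
  have hKc : Continuous fun ζ : sphere (0 : ℂ) 1 => poissonKernel 0 w (ζ : ℂ) := by
    have h : ∀ ζ : sphere (0 : ℂ) 1, ‖(ζ : ℂ) - 0 - (w - 0)‖ ^ 2 ≠ 0 := by
      intro z h0
      have : (z : ℂ) = w := by simpa [sub_eq_zero] using h0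
      have hz : ‖(z : ℂ)‖ = 1 := by simp
      rw [this] at hz
      simp [hz] at hw
    unfold poissonKernel
    fun_prop (disch := assumption)
  have h1 := FiniteMeasure.tendsto_iff_forall_integral_tendsto.1 hlim'
    (BoundedContinuousFunction.mkOfCompact ⟨_, hKc⟩)
  have h2 : Tendsto (fun r : ℝ => (F (r * w)).im) U (nhds (F w).im) := by
    have hc : ContinuousAt F w := (hF.differentiableAt (isOpen_ball.mem_nhds hw)).continuousAt
    have : Tendsto (fun r : ℝ => (r : ℂ) * w) (nhds 1) (nhds w) := by
      have : Continuous fun r : ℝ => (r : ℂ) * w := by fun_prop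
      simpa using this.tendsto 1
    exact (Complex.continuous_im.tendsto _).comp
      (hc.tendsto.comp (this.mono_left (hU.trans nhdsWithin_le_nhds)))
  refine tendsto_nhds_unique h2 (h1.congr' ?_)
  filter_upwards [hU01] with r hr
  exact (hν r hr.1 hr.2 w hw).symm

/-! ### Elementary properties of Stieltjes transforms. -/

section Stieltjes

theorem ofReal_sub_ne_zero {z : ℂ} (hz : z.im ≠ 0) (t : ℝ) : (t : ℂ) - z ≠ 0 := by
  intro h
  have := congrArg Complex.im h
  simp at this
  exact hz this

theorem abs_im_le_norm_ofReal_sub (z : ℂ) (t : ℝ) : |z.im| ≤ ‖(t : ℂ) - z‖ := by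
  have := Complex.abs_im_le_norm ((t : ℂ) - z)
  simpa using this

theorem norm_one_div_ofReal_sub_le {z : ℂ} (hz : z.im ≠ 0) (t : ℝ) :
    ‖1 / ((t : ℂ) - z)‖ ≤ 1 / |z.im| := by
  rw [norm_div, norm_one]
  exact one_div_le_one_div_of_le (abs_pos.2 hz) (abs_im_le_norm_ofReal_sub z t)

theorem continuous_one_div_ofReal_sub {z : ℂ} (hz : z.im ≠ 0) :
    Continuous fun t : ℝ => 1 / ((t : ℂ) - z) :=
  continuous_const.div (by fun_prop) (ofReal_sub_ne_zero hz)

theorem integrable_one_div_ofReal_sub (μ : Measure ℝ) [IsFiniteMeasure μ] {z : ℂ}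
    (hz : z.im ≠ 0) : Integrable (fun t : ℝ => 1 / ((t : ℂ) - z)) μ :=
  Integrable.of_bound (continuous_one_div_ofReal_sub hz).aestronglyMeasurable (1 / |z.im|)
    (ae_of_all _ (norm_one_div_ofReal_sub_le hz))

theorem norm_stieltjes_le (μ : Measure ℝ) [IsFiniteMeasure μ] {z : ℂ} (hz : z.im ≠ 0) :
    ‖stieltjes μ z‖ ≤ 1 / |z.im| * μ.real Set.univ :=
  norm_integral_le_of_norm_le_const (ae_of_all _ (norm_one_div_ofReal_sub_le hz))

theorem one_div_ofReal_sub_im (z : ℂ) (t : ℝ) :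
    (1 / ((t : ℂ) - z)).im = z.im / Complex.normSq ((t : ℂ) - z) := by
  simp [Complex.inv_im]

theorem stieltjes_im (μ : Measure ℝ) [IsFiniteMeasure μ] {z : ℂ} (hz : z.im ≠ 0) :
    (stieltjes μ z).im = ∫ t : ℝ, z.im / Complex.normSq ((t : ℂ) - z) ∂μ := by
  simp only [← one_div_ofReal_sub_im]
  exact (integral_im (integrable_one_div_ofReal_sub μ hz)).symm

theorem stieltjes_eq_resolventTransform (μ : Measure ℝ) (z : ℂ) :
    stieltjes μ z = resolventTransform μ z := by
  simp [stieltjes, resolventTransform_apply, resolvent, Ring.inverse_eq_inv']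

theorem isNevanlinna_stieltjes (μ : Measure ℝ) [IsFiniteMeasure μ] :
    IsNevanlinna (stieltjes μ) where
  holo := by
    intro z hz
    have h : z ∉ algebraMap ℝ ℂ '' μ.support := by
      rintro ⟨t, -, rfl⟩
      simp at hz
    have := (hasDerivAt_resolventTransform z h).differentiableAt
    rw [← funext (stieltjes_eq_resolventTransform μ)] at this
    exact this.differentiableWithinAt
  symm := by
    intro z _
    rw [stieltjes, stieltjes, ← integral_conj]
    simp
  im_nonneg := by
    intro z hz
    rw [stieltjes_im μ hz.ne']
    exact integral_nonneg fun t => div_nonneg hz.le (Complex.normSq_nonneg _)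

theorem tendsto_stieltjes_imaginary_axis (μ : Measure ℝ) [IsFiniteMeasure μ] :
    Tendsto (fun y : ℝ => stieltjes μ (Complex.I * y)) atTop (nhds 0) := by
  have h : Tendsto (fun y : ℝ => 1 / y * μ.real Set.univ) atTop (nhds 0) := by
    simpa using (tendsto_inv_atTop_zero (𝕜 := ℝ)).mul_const (μ.real Set.univ)
  refine squeeze_zero_norm' ?_ h
  filter_upwards [eventually_gt_atTop 0] with y hy
  have := norm_stieltjes_le μ (z := Complex.I * y) (by simpa using hy.ne')
  simpa [abs_of_pos hy] using this

end Stieltjes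

/-! ### Herglotz representation in the half-plane by the Cayley transform. -/

section Herglotz

open Metric

theorem cayley_mem_ball {z : ℂ} (hz : 0 < z.im) :
    (z - Complex.I) / (z + Complex.I) ∈ ball (0 : ℂ) 1 := by
  have h : z + Complex.I ≠ 0 := by
    intro h
    have := congrArg Complex.im h
    simp at this
    linarith
  rw [mem_ball_zero_iff, norm_div, div_lt_one (norm_pos_iff.2 h)]
  have : ‖z - Complex.I‖ ^ 2 < ‖z + Complex.I‖ ^ 2 := by
    rw [← Complex.normSq_eq_norm_sq, ← Complex.normSq_eq_norm_sq, Complex.normSq_apply,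
      Complex.normSq_apply]
    simp
    nlinarith
  exact lt_of_pow_lt_pow_left₀ 2 (norm_nonneg _) this

theorem inverseCayley_im {w : ℂ} (hw : w ≠ 1) :
    (Complex.I * (1 + w) / (1 - w)).im = (1 - ‖w‖ ^ 2) / ‖1 - w‖ ^ 2 := by
  have h : 1 - w ≠ 0 := sub_ne_zero.2 hw.symm
  have h' : Complex.normSq (1 - w) ≠ 0 := by simpa using h
  rw [← Complex.normSq_eq_norm_sq, ← Complex.normSq_eq_norm_sq, Complex.div_im]
  rw [← sub_div]
  congr 1
  simp [Complex.normSq_apply]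
  ring

theorem inverseCayley_cayley {z : ℂ} (hz : 0 < z.im) :
    Complex.I * (1 + (z - Complex.I) / (z + Complex.I)) / (1 - (z - Complex.I) / (z + Complex.I))
      = z := by
  have h : z + Complex.I ≠ 0 := by
    intro h
    have := congrArg Complex.im h
    simp at this
    linarith
  have h2 : (1 - (z - Complex.I) / (z + Complex.I)) = 2 * Complex.I / (z + Complex.I) := by
    field_simp
    ring
  rw [h2]
  field_simp
  ring

/-- The Poisson kernel of the disc in the coordinate of the upper half-plane. -/
theorem poissonKernel_cayley {z ζ : ℂ} (hz : 0 < z.im) (hζ : ‖ζ‖ = 1) :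
    poissonKernel 0 ((z - Complex.I) / (z + Complex.I)) ζ =
      4 * z.im / Complex.normSq (Complex.I * (1 + ζ) - z * (1 - ζ)) := by
  have h : z + Complex.I ≠ 0 := by
    intro h
    have := congrArg Complex.im h
    simp at this
    linarith
  have h' : Complex.normSq (z + Complex.I) ≠ 0 := by simpa using h
  have h1 : ζ - (z - Complex.I) / (z + Complex.I) =
      (Complex.I * (1 + ζ) - z * (1 - ζ)) / (z + Complex.I) := by
    field_simp
    ring
  have h2 : 1 - Complex.normSq ((z - Complex.I) / (z + Complex.I)) =
      4 * z.im / Complex.normSq (z + Complex.I) := by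
    rw [Complex.normSq_div, one_sub_div h']
    congr 1
    simp [Complex.normSq_apply]
    ring
  rw [poissonKernel, sub_zero, sub_zero, hζ, one_pow, ← Complex.normSq_eq_norm_sq,
    ← Complex.normSq_eq_norm_sq, h1, h2, Complex.normSq_div, div_div_div_cancel_right₀ h']

end Herglotz

section Herglotz
open Metric

/-- The imaginary part of a Nevanlinna function in terms of a measure on the circle. -/
theorem IsNevanlinna.exists_circle_measure {f : ℂ → ℂ} (hf : IsNevanlinna f) :
    ∃ ν : Measure (sphere (0 : ℂ) 1), IsFiniteMeasure ν ∧ ∀ z : ℂ, 0 < z.im →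
      (f z).im = ∫ ζ : sphere (0 : ℂ) 1,
        4 * z.im / Complex.normSq (Complex.I * (1 + ζ) - z * (1 - ζ)) ∂ν := by
  have him : ∀ w ∈ ball (0 : ℂ) 1, w ≠ 1 ∧ 0 < (Complex.I * (1 + w) / (1 - w)).im := by
    intro w hw
    rw [mem_ball_zero_iff] at hw
    have h1 : w ≠ 1 := by
      rintro rfl
      simp at hw
    refine ⟨h1, ?_⟩
    rw [inverseCayley_im h1]
    have : 0 < ‖1 - w‖ := norm_pos_iff.2 (sub_ne_zero.2 h1.symm)
    have := norm_nonneg w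
    exact div_pos (by nlinarith) (by positivity)
  obtain ⟨ν, hν, h⟩ := exists_poissonIntegral
    (F := fun w => f (Complex.I * (1 + w) / (1 - w)))
    (by
      refine hf.holo.comp ?_ fun w hw => (him w hw).2.ne'
      have : ∀ w ∈ ball (0 : ℂ) 1, 1 - w ≠ 0 := fun w hw => sub_ne_zero.2 (him w hw).1.symm
      fun_prop (disch := assumption))
    (fun w hw => hf.im_nonneg _ (him w hw).2)
  refine ⟨ν, hν, fun z hz => ?_⟩
  have h1 := h _ (cayley_mem_ball hz)
  simp only [inverseCayley_cayley hz] at h1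
  rw [h1]
  exact integral_congr_ae (ae_of_all _ fun ζ => poissonKernel_cayley hz (by simp))

/-- A zero would mean ζ (y + 1) = y - 1, which is impossible for |ζ| = 1 because |y - 1| < y + 1. -/
theorem normSq_cayley_pos {y : ℝ} (hy : 0 < y) {ζ : ℂ} (hζ : ‖ζ‖ = 1) :
    0 < Complex.normSq ((1 + ζ) / y - (1 - ζ)) := by
  rw [Complex.normSq_pos]
  intro h
  have hy' : (y : ℂ) ≠ 0 := by exact_mod_cast hy.ne'
  have h2 : ζ * (y + 1) = y - 1 := by
    field_simp at h
    linear_combination h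
  have h3 := congrArg norm h2
  have e1 : (y : ℂ) + 1 = ((y + 1 : ℝ) : ℂ) := by push_cast; ring
  have e2 : (y : ℂ) - 1 = ((y - 1 : ℝ) : ℂ) := by push_cast; ring
  rw [norm_mul, hζ, e1, e2, Complex.norm_real, Complex.norm_real, one_mul, Real.norm_eq_abs,
    Real.norm_eq_abs, abs_of_pos (by linarith)] at h3
  have : |y - 1| < y + 1 := by
    rw [abs_lt]
    constructor <;> linarith
  linarith

/-- After multiplication by y the kernel converges as y → ∞, to 4 / |1 - ζ|². This limit is the
density that turns the circle measure into the measure on the line. -/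
theorem circle_kernel_imaginary_axis {y : ℝ} (hy : 0 < y) (ζ : ℂ) :
    y * (4 * (Complex.I * y).im /
      Complex.normSq (Complex.I * (1 + ζ) - (Complex.I * y) * (1 - ζ))) =
      4 / Complex.normSq ((1 + ζ) / y - (1 - ζ)) := by
  have hy' : (y : ℂ) ≠ 0 := by exact_mod_cast hy.ne'
  have : Complex.I * (1 + ζ) - (Complex.I * y) * (1 - ζ) =
      Complex.I * y * ((1 + ζ) / y - (1 - ζ)) := by
    field_simp
  rw [this, Complex.normSq_mul, Complex.normSq_mul, Complex.normSq_ofReal, Complex.normSq_I]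
  simp
  by_cases h : Complex.normSq ((1 + ζ) / y - (1 - ζ)) = 0
  · simp [h]
  · field_simp

/-- Fatou's lemma as y → ∞. The density is `⊤` at ζ = 1, so finiteness also excludes a point mass
there, that is, a linear term in the Herglotz representation. -/
theorem lintegral_circle_density_le {f : ℂ → ℂ} {ν : Measure (sphere (0 : ℂ) 1)}
    [IsFiniteMeasure ν] (hν : ∀ z : ℂ, 0 < z.im →
      (f z).im = ∫ ζ : sphere (0 : ℂ) 1,
        4 * z.im / Complex.normSq (Complex.I * (1 + ζ) - z * (1 - ζ)) ∂ν) {C : ℝ}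
    (hC : ∀ᶠ y : ℝ in atTop, y * (f (Complex.I * y)).im ≤ C) :
    ∫⁻ ζ : sphere (0 : ℂ) 1, 4 / ENNReal.ofReal (Complex.normSq (1 - ζ)) ∂ν ≤
      ENNReal.ofReal C := by
  have hmeas : ∀ y : ℝ, Measurable fun ζ : sphere (0 : ℂ) 1 =>
      ENNReal.ofReal (4 / Complex.normSq ((1 + (ζ : ℂ)) / y - (1 - ζ))) := by
    intro y
    have : Continuous fun ζ : sphere (0 : ℂ) 1 =>
      Complex.normSq ((1 + (ζ : ℂ)) / y - (1 - ζ)) := Complex.continuous_normSq.comp (by fun_prop)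
    exact (measurable_const.div this.measurable).ennreal_ofReal
  have hlim : ∀ ζ : sphere (0 : ℂ) 1, Tendsto (fun y : ℝ =>
      ENNReal.ofReal (4 / Complex.normSq ((1 + (ζ : ℂ)) / y - (1 - ζ)))) atTop
      (nhds (4 / ENNReal.ofReal (Complex.normSq (1 - ζ)))) := by
    intro ζ
    have h1 : Tendsto (fun y : ℝ => (1 + (ζ : ℂ)) / y - (1 - ζ)) atTop
        (nhds (0 - (1 - ζ))) := by
      refine Tendsto.sub_const ?_ _
      have := ((Complex.continuous_ofReal.tendsto 0).comp
        (tendsto_inv_atTop_zero (𝕜 := ℝ))).const_mul (1 + (ζ : ℂ))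
      simpa [div_eq_mul_inv, Function.comp_def] using this
    have h2 : Tendsto (fun y : ℝ => 4 / ENNReal.ofReal
        (Complex.normSq ((1 + (ζ : ℂ)) / y - (1 - ζ)))) atTop
        (nhds (4 / ENNReal.ofReal (Complex.normSq (0 - (1 - ζ))))) :=
      ENNReal.Tendsto.const_div (ENNReal.tendsto_ofReal
        ((Complex.continuous_normSq.tendsto _).comp h1)) (Or.inr (by simp))
    rw [zero_sub, Complex.normSq_neg] at h2
    refine h2.congr' ?_
    filter_upwards [eventually_gt_atTop 0] with y hy
    rw [ENNReal.ofReal_div_of_pos (normSq_cayley_pos hy (by simp))]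
    simp
  calc ∫⁻ ζ : sphere (0 : ℂ) 1, 4 / ENNReal.ofReal (Complex.normSq (1 - ζ)) ∂ν
      = ∫⁻ ζ : sphere (0 : ℂ) 1, liminf (fun y : ℝ => ENNReal.ofReal
          (4 / Complex.normSq ((1 + (ζ : ℂ)) / y - (1 - ζ)))) atTop ∂ν :=
        lintegral_congr fun ζ => (hlim ζ).liminf_eq.symm
    _ ≤ liminf (fun y : ℝ => ∫⁻ ζ : sphere (0 : ℂ) 1, ENNReal.ofReal
          (4 / Complex.normSq ((1 + (ζ : ℂ)) / y - (1 - ζ))) ∂ν) atTop :=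
        lintegral_liminf_le hmeas
    _ ≤ ENNReal.ofReal C := by
        refine liminf_le_of_frequently_le' (Eventually.frequently ?_)
        filter_upwards [hC, eventually_gt_atTop 0] with y hyC hy
        have hc : Continuous fun ζ : sphere (0 : ℂ) 1 =>
            4 / Complex.normSq ((1 + (ζ : ℂ)) / y - (1 - ζ)) :=
          continuous_const.div (Complex.continuous_normSq.comp (by fun_prop))
            fun ζ => (normSq_cayley_pos hy (by simp)).ne'
        have hint : Integrable (fun ζ : sphere (0 : ℂ) 1 =>
            4 / Complex.normSq ((1 + (ζ : ℂ)) / y - (1 - ζ))) ν := by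
          have := hc.continuousOn.integrableOn_compact (μ := ν) isCompact_univ
          rwa [integrableOn_univ] at this
        rw [← ofReal_integral_eq_lintegral_ofReal hint
          (ae_of_all _ fun ζ => div_nonneg (by norm_num) (Complex.normSq_nonneg _))]
        refine ENNReal.ofReal_le_ofReal (le_trans (le_of_eq ?_) hyC)
        rw [hν _ (by simpa using hy), ← integral_const_mul]
        exact integral_congr_ae (ae_of_all _ fun ζ => (circle_kernel_imaginary_axis hy _).symm)

/-- A Nevanlinna function `f` with `f(iy) = O(1/y)` is the Stieltjes transform of a finite
measure. -/
theorem IsNevanlinna.exists_stieltjes {f : ℂ → ℂ} (hf : IsNevanlinna f) {C : ℝ}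
    (hC : ∀ᶠ y : ℝ in atTop, y * (f (Complex.I * y)).im ≤ C)
    (h0 : Tendsto (fun y : ℝ => f (Complex.I * y)) atTop (nhds 0)) :
    ∃ μ : Measure ℝ, IsFiniteMeasure μ ∧ ∀ z : ℂ, z.im ≠ 0 → f z = stieltjes μ z := by
  obtain ⟨ν, hνfin, hν⟩ := hf.exists_circle_measure
  have hle := lintegral_circle_density_le hν hC
  -- In the coordinate t = i (1 + ζ) / (1 - ζ) this density is 1 + t².
  let κ : sphere (0 : ℂ) 1 → ENNReal := fun ζ => 4 / ENNReal.ofReal (Complex.normSq (1 - ζ))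
  have hκ : Measurable κ := by
    have : Continuous fun ζ : sphere (0 : ℂ) 1 => Complex.normSq (1 - (ζ : ℂ)) :=
      Complex.continuous_normSq.comp (by fun_prop)
    exact measurable_const.div this.measurable.ennreal_ofReal
  let T : sphere (0 : ℂ) 1 → ℝ := fun ζ => (Complex.I * (1 + ζ) / (1 - ζ)).re
  have hT : Measurable T := by
    have h1 : Continuous fun ζ : sphere (0 : ℂ) 1 => Complex.I * (1 + (ζ : ℂ)) := by fun_prop
    have h2 : Continuous fun ζ : sphere (0 : ℂ) 1 => 1 - (ζ : ℂ) := by fun_prop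
    exact Complex.measurable_re.comp (h1.measurable.div h2.measurable)
  -- Hence ζ = 1 is a null point, and the default value of `T` there is harmless.
  have hκfin : ∀ᵐ ζ ∂ν, κ ζ < ⊤ := ae_lt_top hκ (hle.trans_lt ENNReal.ofReal_lt_top).ne
  have : IsFiniteMeasure (ν.withDensity κ) :=
    isFiniteMeasure_withDensity (hle.trans_lt ENNReal.ofReal_lt_top).ne
  let μ : Measure ℝ := (ν.withDensity κ).map T
  have hμ : ∀ z : ℂ, 0 < z.im → (f z).im = (stieltjes μ z).im := by
    intro z hz
    have hmeas : Measurable fun t : ℝ => z.im / Complex.normSq ((t : ℂ) - z) := by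
      have : Continuous fun t : ℝ => Complex.normSq ((t : ℂ) - z) :=
        Complex.continuous_normSq.comp (by fun_prop)
      exact measurable_const.div this.measurable
    rw [hν z hz, stieltjes_im μ hz.ne', integral_map hT.aemeasurable
      hmeas.aestronglyMeasurable, integral_withDensity_eq_integral_toReal_smul hκ hκfin]
    refine integral_congr_ae ?_
    filter_upwards [hκfin] with ζ hζ
    have hζ1 : (ζ : ℂ) ≠ 1 := by
      intro h
      simp [κ, h, ENNReal.div_zero] at hζ
    have hsub : 1 - (ζ : ℂ) ≠ 0 := sub_ne_zero.2 hζ1.symm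
    have hTζ : ((T ζ : ℝ) : ℂ) = Complex.I * (1 + ζ) / (1 - ζ) := by
      refine Complex.ext (by simp [T]) ?_
      rw [inverseCayley_im hζ1]
      simp
    have hn : Complex.normSq (1 - (ζ : ℂ)) ≠ 0 := by simpa using hsub
    have e : (κ ζ).toReal = 4 / Complex.normSq (1 - (ζ : ℂ)) := by
      simp [κ, ENNReal.toReal_div, ENNReal.toReal_ofReal (Complex.normSq_nonneg _)]
    have e2 : Complex.I * (1 + (ζ : ℂ)) - z * (1 - ζ) = (1 - ζ) * ((T ζ : ℂ) - z) := by
      rw [hTζ]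
      field_simp
    rw [e, e2, Complex.normSq_mul, smul_eq_mul, div_mul_div_comm]
  refine ⟨μ, inferInstance, ?_⟩
  have hS := isNevanlinna_stieltjes μ
  have hopen : IsOpen {z : ℂ | 0 < z.im} := isOpen_lt continuous_const Complex.continuous_im
  -- The imaginary parts agree on the half-plane, so the difference is a constant, and the limit
  -- along the imaginary axis shows that it is 0.
  have han : AnalyticOnNhd ℂ (fun z => f z - stieltjes μ z) {z : ℂ | 0 < z.im} :=
    DifferentiableOn.analyticOnNhd (DifferentiableOn.mono (hf.holo.sub hS.holo)
      fun z hz => ne_of_gt hz) hopen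
  obtain ⟨c, hc⟩ := han.eq_const_of_im_eq_const (c₀ := 0)
    (fun z hz => by rw [Complex.sub_im, hμ z hz, sub_self])
    hopen ((convex_halfSpace_im_gt 0).isConnected ⟨Complex.I, by simp⟩)
  have hlim : Tendsto (fun y : ℝ => f (Complex.I * y) - stieltjes μ (Complex.I * y)) atTop
      (nhds 0) := by
    simpa using h0.sub (tendsto_stieltjes_imaginary_axis μ)
  have hc0 : c = 0 := by
    refine tendsto_nhds_unique (tendsto_const_nhds.congr' ?_) hlim
    filter_upwards [eventually_gt_atTop 0] with y hy
    exact (hc _ (by simpa using hy)).symm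
  have hup : ∀ z : ℂ, 0 < z.im → f z = stieltjes μ z := fun z hz =>
    sub_eq_zero.1 ((hc z hz).trans hc0)
  intro z hz
  rcases lt_or_gt_of_ne hz with h | h
  · have h' : 0 < (starRingEnd ℂ z).im := by simpa using h
    have := hup _ h'
    rw [hf.symm z hz, hS.symm z hz] at this
    exact (starRingEnd ℂ).injective this
  · exact hup z h

end Herglotz

/-! ### Remainder of the moment expansion and its limit in sectors. -/

section Moments

theorem integrable_pow_of_le {μ : Measure ℝ} [IsFiniteMeasure μ] {a b : ℕ} (hab : a ≤ b)
    (hb : Integrable (fun t : ℝ => t ^ b) μ) : Integrable (fun t : ℝ => t ^ a) μ := by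
  refine ((integrable_const (1 : ℝ)).add hb.norm).mono'
    (by fun_prop) (ae_of_all _ fun t => ?_)
  simp only [Pi.add_apply, norm_pow]
  rcases le_total ‖t‖ 1 with h | h
  · have := pow_le_one₀ (n := a) (norm_nonneg t) h
    have := pow_nonneg (norm_nonneg t) b
    linarith
  · have := pow_le_pow_right₀ h hab
    linarith

theorem integrable_pow_div_ofReal_sub {μ : Measure ℝ} {m : ℕ}
    (hm : Integrable (fun t : ℝ => t ^ m) μ) {z : ℂ} (hz : z.im ≠ 0) :
    Integrable (fun t : ℝ => (t : ℂ) ^ m / ((t : ℂ) - z)) μ := by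
  have h := (hm.ofReal (𝕜 := ℂ)).mul_bdd
    (continuous_one_div_ofReal_sub hz).aestronglyMeasurable
    (ae_of_all _ (norm_one_div_ofReal_sub_le hz))
  refine h.congr (ae_of_all _ fun t => ?_)
  simp [div_eq_mul_inv]

theorem pow_succ_div_ofReal_sub {z : ℂ} (hz : z.im ≠ 0) (m : ℕ) (t : ℝ) :
    (t : ℂ) ^ (m + 1) / ((t : ℂ) - z) =
      ((t ^ m : ℝ) : ℂ) + z * ((t : ℂ) ^ m / ((t : ℂ) - z)) := by
  have := ofReal_sub_ne_zero hz t
  push_cast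
  field_simp
  ring

theorem integrable_pow_succ_div_ofReal_sub {μ : Measure ℝ} {m : ℕ}
    (hm : Integrable (fun t : ℝ => t ^ m) μ) {z : ℂ} (hz : z.im ≠ 0) :
    Integrable (fun t : ℝ => (t : ℂ) ^ (m + 1) / ((t : ℂ) - z)) μ := by
  simp only [pow_succ_div_ofReal_sub hz]
  exact hm.ofReal.add ((integrable_pow_div_ofReal_sub hm hz).const_mul z)

theorem integral_pow_succ_div_ofReal_sub {μ : Measure ℝ} {m : ℕ}
    (hm : Integrable (fun t : ℝ => t ^ m) μ) {z : ℂ} (hz : z.im ≠ 0) :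
    ∫ t : ℝ, (t : ℂ) ^ (m + 1) / ((t : ℂ) - z) ∂μ =
      ((∫ t : ℝ, t ^ m ∂μ : ℝ) : ℂ) + z * ∫ t : ℝ, (t : ℂ) ^ m / ((t : ℂ) - z) ∂μ := by
  have h : Integrable (fun t : ℝ => ((t ^ m : ℝ) : ℂ)) μ := hm.ofReal
  simp only [pow_succ_div_ofReal_sub hz]
  rw [integral_add h ((integrable_pow_div_ofReal_sub hm hz).const_mul z),
    integral_const_mul, integral_complex_ofReal]

/-- The remainder in the asymptotic expansion of a Stieltjes transform. -/
theorem stieltjes_add_sum {μ : Measure ℝ} {s : ℕ → ℝ} {m : ℕ}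
    (hm : ∀ j < m, Integrable (fun t : ℝ => t ^ j) μ ∧ ∫ t, t ^ j ∂μ = s j)
    {z : ℂ} (hz : z.im ≠ 0) :
    z ^ m * (stieltjes μ z + ∑ j ∈ Finset.range m, (s j : ℂ) / z ^ (j + 1)) =
      ∫ t : ℝ, (t : ℂ) ^ m / ((t : ℂ) - z) ∂μ := by
  have hz0 : z ≠ 0 := by
    rintro rfl
    simp at hz
  induction m with
  | zero => simp [stieltjes]
  | succ m ih =>
    rw [integral_pow_succ_div_ofReal_sub (hm m (Nat.lt_succ_self m)).1 hz,
      ← ih fun j hj => hm j (hj.trans (Nat.lt_succ_self m)), (hm m (Nat.lt_succ_self m)).2,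
      Finset.sum_range_succ]
    field_simp
    ring

theorem sin_le_sin_of_mem_sector {δ θ : ℝ} (hδ : 0 < δ) (h1 : δ < θ) (h2 : θ < Real.pi - δ) :
    Real.sin δ ≤ Real.sin θ := by
  rcases le_total θ (Real.pi / 2) with h | h
  · exact Real.sin_le_sin_of_le_of_le_pi_div_two (by linarith) h h1.le
  · rw [← Real.sin_pi_sub θ]
    exact Real.sin_le_sin_of_le_of_le_pi_div_two (by linarith) (by linarith) (by linarith)

/-- No upper bound on δ is needed: a point of the sector forces δ < π - δ, and otherwise the filter
is trivial. The last inequality is the source of all domination in sectors. -/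
theorem eventually_sectorAtInfty {δ : ℝ} (hδ : 0 < δ) :
    ∀ᶠ z in sectorAtInfty δ, z ≠ 0 ∧ 0 < z.im ∧ 0 < Real.sin δ ∧ ‖z‖ * Real.sin δ ≤ z.im := by
  have h1 : ∀ᶠ z in sectorAtInfty δ, z ≠ 0 :=
    (Bornology.eventually_ne_cobounded (0 : ℂ)).filter_mono inf_le_left
  have h2 : ∀ᶠ z in sectorAtInfty δ, δ < z.arg ∧ z.arg < Real.pi - δ :=
    Eventually.filter_mono inf_le_right (mem_principal_self _)
  filter_upwards [h1, h2] with z hz ⟨ha, hb⟩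
  have hs : 0 < Real.sin δ := Real.sin_pos_of_pos_of_lt_pi hδ (by linarith)
  have him : ‖z‖ * Real.sin δ ≤ z.im := by
    rw [← Complex.norm_mul_sin_arg z]
    exact mul_le_mul_of_nonneg_left (sin_le_sin_of_mem_sector hδ ha hb) (norm_nonneg z)
  exact ⟨hz, lt_of_lt_of_le (mul_pos (norm_pos_iff.2 hz) hs) him, hs, him⟩

/-- Required for dominated convergence along this filter. -/
instance isCountablyGenerated_sectorAtInfty (δ : ℝ) : (sectorAtInfty δ).IsCountablyGenerated := by
  have : (Bornology.cobounded ℂ).IsCountablyGenerated := by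
    rw [← comap_norm_atTop]
    infer_instance
  unfold sectorAtInfty
  infer_instance

/-- Dominated convergence: in the sector |t - z| ≥ Im z ≥ |z| sin δ, so |t^m| / sin δ is a majorant,
while z / (t - z) → -1 for each t. -/
theorem tendsto_mul_integral_sector {μ : Measure ℝ} {m : ℕ}
    (hm : Integrable (fun t : ℝ => t ^ m) μ) {δ : ℝ} (hδ : 0 < δ) :
    Tendsto (fun z : ℂ => z * ∫ t : ℝ, (t : ℂ) ^ m / ((t : ℂ) - z) ∂μ) (sectorAtInfty δ)
      (nhds (-((∫ t : ℝ, t ^ m ∂μ : ℝ) : ℂ))) := by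
  have key : Tendsto (fun z : ℂ => ∫ t : ℝ, z * ((t : ℂ) ^ m / ((t : ℂ) - z)) ∂μ)
      (sectorAtInfty δ) (nhds (∫ t : ℝ, -((t ^ m : ℝ) : ℂ) ∂μ)) := by
    refine tendsto_integral_filter_of_dominated_convergence
      (fun t => |t ^ m| / Real.sin δ) ?_ ?_ (hm.abs.div_const _) ?_
    · filter_upwards [eventually_sectorAtInfty hδ] with z hz
      exact ((integrable_pow_div_ofReal_sub hm hz.2.1.ne').const_mul z).aestronglyMeasurable
    · filter_upwards [eventually_sectorAtInfty hδ] with z ⟨hz0, him, hs, hle⟩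
      refine ae_of_all _ fun t => ?_
      have h1 : ‖z‖ * Real.sin δ ≤ ‖(t : ℂ) - z‖ :=
        hle.trans ((le_abs_self _).trans (abs_im_le_norm_ofReal_sub z t))
      have h2 : 0 < ‖(t : ℂ) - z‖ := norm_pos_iff.2 (ofReal_sub_ne_zero him.ne' t)
      rw [norm_mul, norm_div, norm_pow, Complex.norm_real, Real.norm_eq_abs, ← abs_pow,
        ← mul_div_assoc, div_le_div_iff₀ h2 hs]
      nlinarith [abs_nonneg (t ^ m)]
    · refine ae_of_all _ fun t => ?_
      have h1 : Tendsto (fun z : ℂ => (t : ℂ) * z⁻¹) (Bornology.cobounded ℂ) (nhds 0) := by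
        simpa using (tendsto_inv₀_cobounded (α := ℂ)).const_mul (t : ℂ)
      have h2 : Tendsto (fun z : ℂ => (t : ℂ) ^ m / ((t : ℂ) * z⁻¹ - 1)) (Bornology.cobounded ℂ)
          (nhds ((t : ℂ) ^ m / (0 - 1))) :=
        tendsto_const_nhds.div (h1.sub_const 1) (by norm_num)
      have h3 : (t : ℂ) ^ m / (0 - 1) = -((t ^ m : ℝ) : ℂ) := by
        push_cast
        ring
      rw [h3] at h2
      refine (h2.mono_left (inf_le_left : sectorAtInfty δ ≤ _)).congr' ?_
      filter_upwards [eventually_sectorAtInfty hδ] with z ⟨hz0, him, _, _⟩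
      have h4 := ofReal_sub_ne_zero him.ne' t
      have h5 : (t : ℂ) * z⁻¹ - 1 = ((t : ℂ) - z) / z := by
        field_simp
      rw [h5]
      field_simp
  have e : ∫ t : ℝ, -((t ^ m : ℝ) : ℂ) ∂μ = -((∫ t : ℝ, t ^ m ∂μ : ℝ) : ℂ) := by
    rw [integral_neg, integral_complex_ofReal]
  rw [e] at key
  simpa only [integral_const_mul] using key

theorem tendsto_I_mul_sectorAtInfty :
    Tendsto (fun y : ℝ => Complex.I * y) atTop (sectorAtInfty (Real.pi / 4)) := by
  refine tendsto_inf.2 ⟨?_, tendsto_principal.2 ?_⟩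
  · rw [← tendsto_norm_atTop_iff_cobounded]
    refine tendsto_id.congr' ?_
    filter_upwards [eventually_ge_atTop 0] with y hy
    simp [abs_of_nonneg hy]
  · filter_upwards [eventually_gt_atTop 0] with y hy
    have : (Complex.I * (y : ℂ)).arg = Real.pi / 2 := by
      rw [mul_comm, Complex.arg_real_mul _ hy, Complex.arg_I]
    have := Real.pi_pos
    constructor <;> linarith

end Moments

/-! ### The Hamburger–Nevanlinna theorem. -/

section Expansion

/-- The scaled remainder `z^{m+1} (φ(z) + s_0/z + ⋯ + s_m/z^{m+1})` of the expansion at `∞`. -/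
noncomputable def scaledRemainder (s : ℕ → ℝ) (m : ℕ) (φ : ℂ → ℂ) (z : ℂ) : ℂ :=
  z ^ (m + 1) * (φ z + ∑ j ∈ Finset.range (m + 1), (s j : ℂ) / z ^ (j + 1))

theorem ntLittleO_expansion_iff (s : ℕ → ℝ) (m : ℕ) (φ : ℂ → ℂ) :
    NTLittleO (fun z => φ z - ∑ j ∈ Finset.range (m + 1), -((s j : ℂ) / z ^ (j + 1)))
      (fun z => 1 / z ^ (m + 1)) ↔
    ∀ δ : ℝ, 0 < δ → Tendsto (scaledRemainder s m φ) (sectorAtInfty δ) (nhds 0) := by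
  refine forall₂_congr fun δ hδ => ?_
  rw [isLittleO_iff_tendsto']
  · refine tendsto_congr fun z => ?_
    rw [scaledRemainder, Finset.sum_neg_distrib, sub_neg_eq_add, div_div_eq_mul_div, div_one,
      mul_comm]
  · filter_upwards [eventually_sectorAtInfty hδ] with z hz h
    have := hz.1
    simp [this] at h

theorem scaledRemainder_succ (s : ℕ → ℝ) (m : ℕ) (φ : ℂ → ℂ) {z : ℂ} (hz : z ≠ 0) :
    scaledRemainder s (m + 1) φ z = z * scaledRemainder s m φ z + s (m + 1) := by
  rw [scaledRemainder, scaledRemainder, Finset.sum_range_succ _ (m + 1)]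
  field_simp
  ring

theorem tendsto_inv_sector {α : Type*} {l : Filter α} {u : α → ℂ} {δ : ℝ}
    (hu : Tendsto u l (sectorAtInfty δ)) : Tendsto (fun a => (u a)⁻¹) l (nhds 0) :=
  (tendsto_inv₀_cobounded (α := ℂ)).comp (hu.mono_right inf_le_left)

/-- By `scaledRemainder_succ` the remainder of order m is that of order m + 1, less s_{m+1}, divided
by z. The map `u` allows both whole sectors and the imaginary axis. -/
theorem tendsto_scaledRemainder_of_le {α : Type*} {l : Filter α} {u : α → ℂ} {δ : ℝ} (hδ : 0 < δ)
    (hu : Tendsto u l (sectorAtInfty δ)) {s : ℕ → ℝ} {φ : ℂ → ℂ} {m M : ℕ} (hmM : m ≤ M)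
    (h : Tendsto (fun a => scaledRemainder s M φ (u a)) l (nhds 0)) :
    Tendsto (fun a => scaledRemainder s m φ (u a)) l (nhds 0) := by
  induction M, hmM using Nat.le_induction with
  | base => exact h
  | succ M _ ih =>
    refine ih ?_
    have h1 := (h.sub_const (s (M + 1) : ℂ)).mul (tendsto_inv_sector hu)
    rw [mul_zero] at h1
    refine h1.congr' ?_
    filter_upwards [hu.eventually (eventually_sectorAtInfty hδ)] with a ha
    rw [scaledRemainder_succ s M φ ha.1]
    have := ha.1
    field_simp
    ring

/-- If the moments up to order `m` exist, and those below `m` are `s_0, …, s_{m-1}`. -/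
theorem scaledRemainder_stieltjes {μ : Measure ℝ} {s : ℕ → ℝ} {m : ℕ}
    (hm : ∀ j < m, Integrable (fun t : ℝ => t ^ j) μ ∧ ∫ t, t ^ j ∂μ = s j)
    {z : ℂ} (hz : z.im ≠ 0) :
    scaledRemainder s m (stieltjes μ) z =
      s m + z * ∫ t : ℝ, (t : ℂ) ^ m / ((t : ℂ) - z) ∂μ := by
  have hz0 : z ≠ 0 := by
    rintro rfl
    simp at hz
  rw [scaledRemainder, ← stieltjes_add_sum hm hz, Finset.sum_range_succ]
  field_simp
  ring

/-- The number s_m is not assumed to be the moment of order m. The limit is the defect, which gives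
the expansion in one direction and `moment_eq_of_tendsto` in the other. -/
theorem tendsto_scaledRemainder_stieltjes {μ : Measure ℝ} {s : ℕ → ℝ} {m : ℕ}
    (hm : ∀ j < m, Integrable (fun t : ℝ => t ^ j) μ ∧ ∫ t, t ^ j ∂μ = s j)
    (hint : Integrable (fun t : ℝ => t ^ m) μ) {δ : ℝ} (hδ : 0 < δ) :
    Tendsto (scaledRemainder s m (stieltjes μ)) (sectorAtInfty δ)
      (nhds (s m - ((∫ t : ℝ, t ^ m ∂μ : ℝ) : ℂ))) := by
  rw [sub_eq_add_neg]
  refine ((tendsto_mul_integral_sector hint hδ).const_add (s m : ℂ)).congr' ?_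
  filter_upwards [eventually_sectorAtInfty hδ] with z hz
  rw [scaledRemainder_stieltjes hm hz.2.1.ne']

theorem IsMomentSolution.isInterpolationSolution {μ : Measure ℝ} [IsFiniteMeasure μ]
    {s : ℕ → ℝ} {l : ℕ} (h : IsMomentSolution s l μ) :
    IsInterpolationSolution s l (stieltjes μ) where
  nevanlinna := isNevanlinna_stieltjes μ
  expansion := by
    rw [ntLittleO_expansion_iff]
    intro δ hδ
    have := tendsto_scaledRemainder_stieltjes (fun j hj => h j hj.le) (h l le_rfl).1 hδ
    rwa [(h l le_rfl).2, sub_self] at this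

/-- If the moments below `m` are the given ones, the moment of order `m` exists and the expansion
of order `m` holds on the imaginary axis, then the moment of order `m` is the given one. -/
theorem moment_eq_of_tendsto {μ : Measure ℝ} {s : ℕ → ℝ} {m : ℕ}
    (hm : ∀ j < m, Integrable (fun t : ℝ => t ^ j) μ ∧ ∫ t, t ^ j ∂μ = s j)
    (hint : Integrable (fun t : ℝ => t ^ m) μ)
    (h : Tendsto (fun y : ℝ => scaledRemainder s m (stieltjes μ) (Complex.I * y)) atTop
      (nhds 0)) : ∫ t, t ^ m ∂μ = s m := by
  have h1 := (tendsto_scaledRemainder_stieltjes hm hint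
    (by have := Real.pi_pos; linarith : 0 < Real.pi / 4)).comp tendsto_I_mul_sectorAtInfty
  have h2 := tendsto_nhds_unique h1 h
  have h3 : (s m : ℂ) = ((∫ t : ℝ, t ^ m ∂μ : ℝ) : ℂ) := sub_eq_zero.1 h2
  exact_mod_cast h3.symm

theorem pow_div_ofReal_sub_I_mul_re (m : ℕ) (y t : ℝ) :
    ((t : ℂ) ^ m / ((t : ℂ) - Complex.I * y)).re = t ^ (m + 1) / (t ^ 2 + y ^ 2) := by
  rw [← Complex.ofReal_pow, Complex.div_re]
  simp [Complex.normSq_apply, -Complex.ofReal_pow]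
  ring

theorem integral_pow_div_I_mul_re {μ : Measure ℝ} {m : ℕ} {y : ℝ}
    (hint : Integrable (fun t : ℝ => (t : ℂ) ^ m / ((t : ℂ) - Complex.I * y)) μ) :
    (∫ t : ℝ, (t : ℂ) ^ m / ((t : ℂ) - Complex.I * y) ∂μ).re =
      ∫ t : ℝ, t ^ (m + 1) / (t ^ 2 + y ^ 2) ∂μ := by
  simp only [← pow_div_ofReal_sub_I_mul_re]
  exact (integral_re hint).symm

/-- Fatou's lemma: y² / (t² + y²) → 1 as y → ∞. The even power makes the integrand nonnegative. -/
theorem integrable_pow_add_two {μ : Measure ℝ} [IsFiniteMeasure μ] {k : ℕ}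
    (hint : Integrable (fun t : ℝ => t ^ (2 * k)) μ) {C : ℝ}
    (hC : ∀ᶠ y : ℝ in atTop, y ^ 2 * ∫ t : ℝ, t ^ (2 * k + 2) / (t ^ 2 + y ^ 2) ∂μ ≤ C) :
    Integrable (fun t : ℝ => t ^ (2 * k + 2)) μ := by
  have hpos : ∀ t : ℝ, 0 ≤ t ^ (2 * k + 2) := fun t => by
    rw [← mul_add_one, pow_mul]; positivity
  have hden : ∀ y : ℝ, y ≠ 0 → ∀ t : ℝ, 0 < t ^ 2 + y ^ 2 := fun y hy t => by positivity
  have hlim : ∀ t : ℝ, Tendsto (fun y : ℝ => ENNReal.ofReal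
      (y ^ 2 * (t ^ (2 * k + 2) / (t ^ 2 + y ^ 2)))) atTop
      (nhds (ENNReal.ofReal (t ^ (2 * k + 2)))) := by
    intro t
    refine ENNReal.tendsto_ofReal ?_
    have h1 : Tendsto (fun y : ℝ => t ^ (2 * k + 2) / (t ^ 2 * (y⁻¹) ^ 2 + 1)) atTop
        (nhds (t ^ (2 * k + 2) / (t ^ 2 * 0 ^ 2 + 1))) := by
      refine tendsto_const_nhds.div ?_ (by norm_num)
      exact (((tendsto_inv_atTop_zero (𝕜 := ℝ)).pow 2).const_mul _).add_const 1
    rw [zero_pow two_ne_zero, mul_zero, zero_add, div_one] at h1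
    refine h1.congr' ?_
    filter_upwards [eventually_gt_atTop 0] with y hy
    have := hden y hy.ne' t
    have h2 : t ^ 2 * (y⁻¹) ^ 2 + 1 = (t ^ 2 + y ^ 2) / y ^ 2 := by
      field_simp
    rw [h2]
    field_simp
  have hle : ∫⁻ t : ℝ, ENNReal.ofReal (t ^ (2 * k + 2)) ∂μ ≤ ENNReal.ofReal C :=
    calc ∫⁻ t : ℝ, ENNReal.ofReal (t ^ (2 * k + 2)) ∂μ
        = ∫⁻ t : ℝ, liminf (fun y : ℝ => ENNReal.ofReal
            (y ^ 2 * (t ^ (2 * k + 2) / (t ^ 2 + y ^ 2)))) atTop ∂μ :=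
          lintegral_congr fun t => (hlim t).liminf_eq.symm
      _ ≤ liminf (fun y : ℝ => ∫⁻ t : ℝ, ENNReal.ofReal
            (y ^ 2 * (t ^ (2 * k + 2) / (t ^ 2 + y ^ 2))) ∂μ) atTop :=
          lintegral_liminf_le fun y => by fun_prop
      _ ≤ ENNReal.ofReal C := by
          refine liminf_le_of_frequently_le' (Eventually.frequently ?_)
          filter_upwards [hC, eventually_gt_atTop 0] with y hyC hy
          have hi : Integrable (fun t : ℝ => t ^ (2 * k + 2) / (t ^ 2 + y ^ 2)) μ := by
            refine hint.mono' (Measurable.aestronglyMeasurable (by fun_prop)) (ae_of_all _ fun t => ?_)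
            have h0 : 0 ≤ t ^ (2 * k) := by rw [pow_mul]; positivity
            rw [Real.norm_of_nonneg (div_nonneg (hpos t) (hden y hy.ne' t).le),
              div_le_iff₀ (hden y hy.ne' t), pow_add]
            nlinarith [sq_nonneg y, mul_nonneg h0 (sq_nonneg y)]
          rw [← ofReal_integral_eq_lintegral_ofReal (hi.const_mul _)
            (ae_of_all _ fun t => mul_nonneg (sq_nonneg y)
              (div_nonneg (hpos t) (hden y hy.ne' t).le)), integral_const_mul]
          exact ENNReal.ofReal_le_ofReal hyC
  refine ⟨by fun_prop, ?_⟩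
  rw [hasFiniteIntegral_iff_ofReal (ae_of_all _ hpos)]
  exact hle.trans_lt ENNReal.ofReal_lt_top

/-- The Hamburger–Nevanlinna theorem: an expansion of the Stieltjes transform on the imaginary
axis gives the moments of even order, and those below them. -/
theorem isMomentSolution_of_tendsto {μ : Measure ℝ} [IsFiniteMeasure μ] {s : ℕ → ℝ} {M k : ℕ}
    (hk : 2 * k ≤ M)
    (h : Tendsto (fun y : ℝ => scaledRemainder s M (stieltjes μ) (Complex.I * y)) atTop
      (nhds 0)) : IsMomentSolution s (2 * k) μ := by
  have hδ : 0 < Real.pi / 4 := by have := Real.pi_pos; linarith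
  have hle : ∀ m ≤ M, Tendsto (fun y : ℝ => scaledRemainder s m (stieltjes μ) (Complex.I * y))
      atTop (nhds 0) := fun m hm =>
    tendsto_scaledRemainder_of_le hδ tendsto_I_mul_sectorAtInfty hm h
  induction k with
  | zero =>
    intro j hj
    obtain rfl : j = 0 := by omega
    have hi : Integrable (fun t : ℝ => t ^ 0) μ := by simp
    exact ⟨hi, moment_eq_of_tendsto (by simp) hi (hle 0 (Nat.zero_le _))⟩
  | succ k ih =>
    have ih := ih (by omega)
    -- With the moments up to 2k known, the real part of the remainder of order 2k + 2 at iy is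
    -- s_{2k+2} - y² ∫ t^{2k+2} / (t² + y²) dμ. It is eventually above -1, whence the bound s_{2k+2}
    -- + 1.
    have hint2 : Integrable (fun t : ℝ => t ^ (2 * k + 2)) μ := by
      refine integrable_pow_add_two (C := s (2 * k + 2) + 1) (ih _ le_rfl).1 ?_
      have h1 := (Complex.continuous_re.tendsto _).comp (hle (2 * k + 2) (by omega))
      have h2 : ∀ᶠ y : ℝ in atTop,
          (scaledRemainder s (2 * k + 2) (stieltjes μ) (Complex.I * y)).re > -1 :=
        h1.eventually (lt_mem_nhds (by simp))
      filter_upwards [h2, eventually_gt_atTop 0] with y hy2 hy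
      have him : (Complex.I * (y : ℂ)).im ≠ 0 := by simpa using hy.ne'
      rw [scaledRemainder_succ s (2 * k + 1) _ (by rintro h; simp [h] at him),
        scaledRemainder_stieltjes (fun j hj => ih j (by omega)) him] at hy2
      have h3 := integral_pow_div_I_mul_re (μ := μ) (m := 2 * k + 1)
        (integrable_pow_succ_div_ofReal_sub (ih _ le_rfl).1 him)
      rw [← h3]
      set J := ∫ t : ℝ, (t : ℂ) ^ (2 * k + 1) / ((t : ℂ) - Complex.I * y) ∂μ
      have h4 : (Complex.I * (y : ℂ) * (s (2 * k + 1) + Complex.I * y * J) +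
          (s (2 * k + 1 + 1) : ℂ)).re = - (y ^ 2 * J.re) + s (2 * k + 2) := by
        simp
        ring
      rw [h4] at hy2
      linarith
    -- The odd power is integrable only because the next even one is, so the argument always ends at
    -- an even order.
    have hint1 : Integrable (fun t : ℝ => t ^ (2 * k + 1)) μ :=
      integrable_pow_of_le (by omega) hint2
    have heq1 := moment_eq_of_tendsto (fun j hj => ih j (by omega)) hint1
      (hle (2 * k + 1) (by omega))
    have h1 : ∀ j < 2 * k + 2, Integrable (fun t : ℝ => t ^ j) μ ∧ ∫ t, t ^ j ∂μ = s j := by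
      intro j hj
      rcases (by omega : j ≤ 2 * k ∨ j = 2 * k + 1) with hj | rfl
      · exact ih j hj
      · exact ⟨hint1, heq1⟩
    have heq2 := moment_eq_of_tendsto h1 hint2 (hle (2 * k + 2) (by omega))
    intro j hj
    rcases (by omega : j < 2 * k + 2 ∨ j = 2 * k + 2) with hj | rfl
    · exact h1 j hj
    · exact ⟨hint2, heq2⟩

/-- A solution of the interpolation problem is the Stieltjes transform of a finite measure. -/
theorem IsInterpolationSolution.exists_stieltjes {s : ℕ → ℝ} {l : ℕ} {φ : ℂ → ℂ}
    (h : IsInterpolationSolution s l φ) :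
    ∃ μ : Measure ℝ, IsFiniteMeasure μ ∧ ∀ z : ℂ, z.im ≠ 0 → φ z = stieltjes μ z := by
  have hδ : 0 < Real.pi / 4 := by have := Real.pi_pos; linarith
  have h0 : Tendsto (fun y : ℝ => scaledRemainder s 0 φ (Complex.I * y)) atTop (nhds 0) :=
    tendsto_scaledRemainder_of_le hδ tendsto_I_mul_sectorAtInfty (Nat.zero_le l)
      (((ntLittleO_expansion_iff s l φ).1 h.expansion _ hδ).comp tendsto_I_mul_sectorAtInfty)
  -- The limit iy φ(iy) → -s_0 yields both hypotheses of the Stieltjes representation: y Im φ(iy) is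
  -- bounded and φ(iy) → 0.
  have h1 : Tendsto (fun y : ℝ => Complex.I * y * φ (Complex.I * y)) atTop (nhds (-s 0)) := by
    have := h0.sub_const (s 0 : ℂ)
    rw [zero_sub] at this
    refine this.congr' ?_
    filter_upwards [eventually_gt_atTop 0] with y hy
    have : (y : ℂ) ≠ 0 := by exact_mod_cast hy.ne'
    simp [scaledRemainder]
    field_simp
    ring
  refine h.nevanlinna.exists_stieltjes (C := s 0 + 1) ?_ ?_
  · have h2 := (Complex.continuous_re.tendsto _).comp h1
    have h3 : ∀ᶠ y : ℝ in atTop, (Complex.I * y * φ (Complex.I * y)).re > -s 0 - 1 :=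
      h2.eventually (lt_mem_nhds (by simp))
    filter_upwards [h3] with y hy
    simp at hy
    linarith
  · have := h1.mul (tendsto_inv_sector tendsto_I_mul_sectorAtInfty)
    rw [mul_zero] at this
    refine this.congr' ?_
    filter_upwards [eventually_gt_atTop 0] with y hy
    have : (y : ℂ) ≠ 0 := by exact_mod_cast hy.ne'
    field_simp

end Expansion

/-! ### The moment functional and polynomials of the second kind. -/

section Functional

/-- The moment functional on real polynomials. -/
noncomputable def realMoment (s : ℕ → ℝ) : ℝ[X] →ₗ[ℝ] ℝ :=
  Polynomial.lsum fun j => s j • LinearMap.id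

theorem realMoment_X_pow (s : ℕ → ℝ) (j : ℕ) : realMoment s (X ^ j) = s j := by
  rw [realMoment, lsum_apply, ← monomial_one_right_eq_X_pow, sum_monomial_index] <;> simp

/-- The moment functional as a linear map. -/
noncomputable def momentLinear (s : ℕ → ℝ) : ℂ[X] →ₗ[ℂ] ℂ :=
  Polynomial.lsum fun j => (s j : ℂ) • LinearMap.id

theorem momentFunctional_eq (s : ℕ → ℝ) (p : ℂ[X]) : momentFunctional s p = momentLinear s p := by
  simp [momentFunctional, momentLinear, lsum_apply, mul_comm]

theorem momentFunctional_map (s : ℕ → ℝ) (p : ℝ[X]) :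
    momentFunctional s (p.map (algebraMap ℝ ℂ)) = (realMoment s p : ℂ) := by
  rw [momentFunctional, sum_over_range' _ (by simp) (p.natDegree + 1)
    (Nat.lt_succ_of_le natDegree_map_le), realMoment, lsum_apply,
    sum_over_range' _ (by simp) (p.natDegree + 1) (Nat.lt_succ_self _)]
  simp [mul_comm]

theorem firstKind_eq_aeval (P : ℝ[X]) (z : ℂ) : firstKind P z = aeval z P := by
  rw [firstKind, eval_map, aeval_def]

/-- The difference quotient of a polynomial is determined by its defining identity. -/
theorem diffQuotient_unique (p : ℂ[X]) (z a : ℂ) (q : ℂ[X]) (h : (X - C z) * q = p - C a) :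
    (p - C a) /ₘ (X - C z) = q := by
  rw [← h, mul_divByMonic_cancel_left _ (monic_X_sub_C z)]

theorem mul_diffQuotient (p : ℂ[X]) (z : ℂ) :
    (X - C z) * ((p - C (p.eval z)) /ₘ (X - C z)) = p - C (p.eval z) :=
  mul_divByMonic_eq_iff_isRoot.2 (by simp)

theorem secondKind_add (s : ℕ → ℝ) (P R : ℝ[X]) (z : ℂ) :
    secondKind s (P + R) z = secondKind s P z + secondKind s R z := by
  simp only [secondKind, momentFunctional_eq, firstKind]
  rw [← map_add]
  congr 1
  refine diffQuotient_unique _ _ _ _ ?_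
  rw [mul_add, mul_diffQuotient, mul_diffQuotient]
  simp only [Polynomial.map_add, eval_add, C_add]
  ring

theorem secondKind_smul (s : ℕ → ℝ) (c : ℝ) (P : ℝ[X]) (z : ℂ) :
    secondKind s (c • P) z = c * secondKind s P z := by
  simp only [secondKind, momentFunctional_eq, firstKind]
  rw [← smul_eq_mul, ← map_smul]
  congr 1
  refine diffQuotient_unique _ _ _ _ ?_
  rw [mul_smul_comm, mul_diffQuotient]
  simp [smul_eq_C_mul, mul_sub]

/-- From (t P(t) - z P(z)) / (t - z) = z (P(t) - P(z)) / (t - z) + P(t). The extra term vanishes for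
P_k with k ≥ 1, so the Q_k inherit the recurrence of the P_k from the second row on. -/
theorem secondKind_X_mul (s : ℕ → ℝ) (P : ℝ[X]) (z : ℂ) :
    secondKind s (X * P) z = z * secondKind s P z + realMoment s P := by
  rw [← momentFunctional_map]
  simp only [secondKind, momentFunctional_eq, firstKind]
  rw [← smul_eq_mul (a := z), ← map_smul, ← map_add]
  congr 1
  refine diffQuotient_unique _ _ _ _ ?_
  rw [mul_add, mul_smul_comm, mul_diffQuotient]
  simp [smul_eq_C_mul]
  ring

theorem secondKind_C (s : ℕ → ℝ) (c : ℝ) (z : ℂ) : secondKind s (C c) z = 0 := by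
  simp [secondKind, momentFunctional_eq, firstKind]

/-- `P ↦ P(z)` as a linear map. -/
noncomputable def firstKindLinear (z : ℂ) : ℝ[X] →ₗ[ℝ] ℂ := (aeval z).toLinearMap

theorem firstKindLinear_apply (z : ℂ) (P : ℝ[X]) : firstKindLinear z P = firstKind P z :=
  (firstKind_eq_aeval P z).symm

/-- `P ↦ Q(z)` as a linear map. -/
noncomputable def secondKindLinear (s : ℕ → ℝ) (z : ℂ) : ℝ[X] →ₗ[ℝ] ℂ where
  toFun P := secondKind s P z
  map_add' P R := secondKind_add s P R z
  map_smul' c P := by simp [secondKind_smul]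

theorem secondKindLinear_apply (s : ℕ → ℝ) (z : ℂ) (P : ℝ[X]) :
    secondKindLinear s z P = secondKind s P z := rfl

theorem secondKind_X_pow_succ (s : ℕ → ℝ) (i : ℕ) (z : ℂ) :
    secondKind s (X ^ (i + 1)) z = z * secondKind s (X ^ i) z + s i := by
  rw [pow_succ', secondKind_X_mul, realMoment_X_pow]

theorem firstKind_X_pow (i : ℕ) (z : ℂ) : firstKind (X ^ i) z = z ^ i := by
  simp [firstKind]

theorem firstKind_conj (P : ℝ[X]) (z : ℂ) :
    firstKind P (starRingEnd ℂ z) = starRingEnd ℂ (firstKind P z) := by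
  rw [firstKind_eq_aeval, firstKind_eq_aeval, aeval_conj]

theorem secondKind_conj (s : ℕ → ℝ) (P : ℝ[X]) (z : ℂ) :
    secondKind s P (starRingEnd ℂ z) = starRingEnd ℂ (secondKind s P z) := by
  induction P using Polynomial.induction_on' with
  | add p q hp hq => simp [secondKind_add, hp, hq]
  | monomial i a =>
    rw [← C_mul_X_pow_eq_monomial, ← smul_eq_C_mul, secondKind_smul, secondKind_smul, map_mul,
      Complex.conj_ofReal]
    congr 1
    induction i with
    | zero =>
      have : (X ^ 0 : ℝ[X]) = C 1 := by simp
      simp only [this, secondKind_C, map_zero]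
    | succ i ih => simp [secondKind_X_pow_succ, ih]

/-- For a measure with the right moments, `P φ + Q` is the integral of `P(t) / (t - z)`. -/
theorem firstKind_mul_stieltjes_add {μ : Measure ℝ} [IsFiniteMeasure μ] {s : ℕ → ℝ} {l : ℕ}
    (hμ : IsMomentSolution s l μ) {P : ℝ[X]} (hP : P.natDegree ≤ l) {z : ℂ} (hz : z.im ≠ 0) :
    Integrable (fun t : ℝ => ((P.eval t : ℝ) : ℂ) / ((t : ℂ) - z)) μ ∧
    firstKind P z * stieltjes μ z + secondKind s P z =
      ∫ t : ℝ, ((P.eval t : ℝ) : ℂ) / ((t : ℂ) - z) ∂μ := by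
  have hpow : ∀ i ≤ l, firstKind (X ^ i) z * stieltjes μ z + secondKind s (X ^ i) z =
      ∫ t : ℝ, (t : ℂ) ^ i / ((t : ℂ) - z) ∂μ := by
    intro i hi
    induction i with
    | zero =>
      have : secondKind s (X ^ 0) z = 0 := by
        rw [pow_zero, ← C_1, secondKind_C]
      rw [this]
      simp [firstKind, stieltjes]
    | succ i ih =>
      have h := hμ i (by omega)
      rw [integral_pow_succ_div_ofReal_sub h.1 hz, ← ih (by omega), h.2,
        secondKind_X_pow_succ, firstKind_X_pow, firstKind_X_pow]
      ring
  have hint : ∀ i ∈ Finset.range (l + 1), Integrable (fun t : ℝ =>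
      (P.coeff i : ℂ) * ((t : ℂ) ^ i / ((t : ℂ) - z))) μ := fun i hi =>
    (integrable_pow_div_ofReal_sub (hμ i (by simpa [Nat.lt_succ_iff] using hi)).1 hz).const_mul _
  have heval : ∀ t : ℝ, ((P.eval t : ℝ) : ℂ) / ((t : ℂ) - z) =
      ∑ i ∈ Finset.range (l + 1), (P.coeff i : ℂ) * ((t : ℂ) ^ i / ((t : ℂ) - z)) := by
    intro t
    rw [eval_eq_sum_range' (Nat.lt_succ_of_le hP) t]
    push_cast
    rw [Finset.sum_div]
    exact Finset.sum_congr rfl fun i _ => by ring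
  simp only [heval]
  refine ⟨integrable_finsetSum _ hint, ?_⟩
  rw [integral_finsetSum _ hint]
  have hP' : P = ∑ i ∈ Finset.range (l + 1), P.coeff i • (X ^ i : ℝ[X]) := by
    conv_lhs => rw [P.as_sum_range' (l + 1) (Nat.lt_succ_of_le hP)]
    exact Finset.sum_congr rfl fun i _ => by rw [smul_eq_C_mul, C_mul_X_pow_eq_monomial]
  rw [← firstKindLinear_apply, ← secondKindLinear_apply]
  conv_lhs => rw [hP']
  rw [map_sum, map_sum, Finset.sum_mul, ← Finset.sum_add_distrib]
  refine Finset.sum_congr rfl fun i hi => ?_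
  rw [integral_const_mul, ← hpow i (by simpa [Nat.lt_succ_iff] using hi), map_smul, map_smul,
    firstKindLinear_apply, secondKindLinear_apply, Complex.real_smul, Complex.real_smul]
  ring

/-- The integral of a polynomial against a measure with the right moments. -/
theorem integral_eval {μ : Measure ℝ} {s : ℕ → ℝ} {l : ℕ}
    (hμ : IsMomentSolution s l μ) {P : ℝ[X]} (hP : P.natDegree ≤ l) :
    Integrable (fun t : ℝ => P.eval t) μ ∧ ∫ t, P.eval t ∂μ = realMoment s P := by
  have hint : ∀ i ∈ Finset.range (l + 1), Integrable (fun t : ℝ => P.coeff i * t ^ i) μ :=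
    fun i hi => (hμ i (by simpa [Nat.lt_succ_iff] using hi)).1.const_mul _
  simp only [eval_eq_sum_range' (Nat.lt_succ_of_le hP)]
  refine ⟨integrable_finsetSum _ hint, ?_⟩
  rw [integral_finsetSum _ hint]
  conv_rhs => rw [P.as_sum_range' (l + 1) (Nat.lt_succ_of_le hP)]
  rw [map_sum]
  refine Finset.sum_congr rfl fun i hi => ?_
  rw [integral_const_mul, (hμ i (by simpa [Nat.lt_succ_iff] using hi)).2,
    ← C_mul_X_pow_eq_monomial, ← smul_eq_C_mul, map_smul, realMoment_X_pow, smul_eq_mul]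

end Functional

/-! ### Orthogonal polynomials and the Jacobi recurrence. -/

section Orthogonal

/-- The value is the quadratic form of the Hankel matrix at the coefficient vector of p. -/
theorem realMoment_mul_self_pos {s : ℕ → ℝ} {n : ℕ} (hS : (hankel s n).PosDef) {p : ℝ[X]}
    (hp : p ≠ 0) (hdeg : p.natDegree ≤ n) : 0 < realMoment s (p * p) := by
  have h1 : (fun i : Fin (n + 1) => p.coeff i) ≠ 0 := by
    intro h
    refine hp (Polynomial.ext fun i => ?_)
    rcases Nat.lt_or_ge i (n + 1) with hi | hi
    · simpa using congrFun h ⟨i, hi⟩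
    · rw [coeff_zero, coeff_eq_zero_of_natDegree_lt (by omega)]
  have h2 := hS.dotProduct_mulVec_pos h1
  refine h2.trans_eq ?_
  have hp' : p = ∑ i : Fin (n + 1), p.coeff i • (X ^ (i : ℕ) : ℝ[X]) := by
    rw [Fin.sum_univ_eq_sum_range (fun i => p.coeff i • (X ^ i : ℝ[X]))]
    conv_lhs => rw [p.as_sum_range' (n + 1) (Nat.lt_succ_of_le hdeg)]
    exact Finset.sum_congr rfl fun i _ => by rw [smul_eq_C_mul, C_mul_X_pow_eq_monomial]
  have e : p * p = _ := congrArg₂ (· * ·) hp' hp'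
  rw [e, Finset.sum_mul_sum]
  simp only [map_sum, smul_mul_smul_comm, ← pow_add, map_smul,
    realMoment_X_pow, dotProduct, Matrix.mulVec, hankel, Matrix.of_apply, Finset.mul_sum,
    star_trivial, smul_eq_mul]
  exact Finset.sum_congr rfl fun i _ => Finset.sum_congr rfl fun j _ => by ring

theorem eq_zero_of_realMoment_mul_self {s : ℕ → ℝ} {n : ℕ} (hS : (hankel s n).PosDef) {p : ℝ[X]}
    (hdeg : p.degree < (n + 1 : ℕ)) (h : realMoment s (p * p) = 0) : p = 0 := by
  by_contra hp
  have := realMoment_mul_self_pos hS hp (Nat.lt_succ_iff.1 ((natDegree_lt_iff_degree_lt hp).2 hdeg))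
  exact this.ne' h

/-- Pairing polynomials of degree < k with the powers below k is injective by definiteness, hence
surjective for dimension reasons, and so X^k can be corrected. For k = n + 1 definiteness in degrees
≤ n still suffices. -/
theorem exists_monic_orthogonal {s : ℕ → ℝ} {n k : ℕ} (hS : (hankel s n).PosDef)
    (hk : k ≤ n + 1) :
    ∃ p : ℝ[X], p.Monic ∧ p.natDegree = k ∧ ∀ j < k, realMoment s (p * X ^ j) = 0 := by
  let A : degreeLT ℝ k →ₗ[ℝ] (Fin k → ℝ) := LinearMap.pi fun j =>
    realMoment s ∘ₗ LinearMap.mulRight ℝ (X ^ (j : ℕ)) ∘ₗ (degreeLT ℝ k).subtype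
  have hA : ∀ (p : degreeLT ℝ k) (j : Fin k), A p j = realMoment s ((p : ℝ[X]) * X ^ (j : ℕ)) :=
    fun _ _ => rfl
  have hinj : Function.Injective A := by
    rw [injective_iff_map_eq_zero]
    intro p hp
    have hdeg : (p : ℝ[X]).degree < k := mem_degreeLT.1 p.2
    refine Subtype.ext (eq_zero_of_realMoment_mul_self hS
      (hdeg.trans_le (by exact_mod_cast hk)) ?_)
    by_cases h0 : (p : ℝ[X]) = 0
    · simp [h0]
    conv_lhs =>
      enter [2, 2]
      rw [(p : ℝ[X]).as_sum_range' k ((natDegree_lt_iff_degree_lt h0).2 hdeg)]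
    rw [Finset.mul_sum, map_sum]
    refine Finset.sum_eq_zero fun i hi => ?_
    rw [← C_mul_X_pow_eq_monomial, ← smul_eq_C_mul, mul_smul_comm, map_smul]
    have := congrFun hp ⟨i, Finset.mem_range.1 hi⟩
    rw [hA] at this
    simp only [Pi.zero_apply] at this
    rw [this, smul_zero]
  have hfin : Module.Finite ℝ (degreeLT ℝ k) := Module.Finite.equiv (degreeLTEquiv ℝ k).symm
  have hsurj := (LinearMap.injective_iff_surjective_of_finrank_eq_finrank
    (degreeLTEquiv ℝ k).finrank_eq).1 hinj
  obtain ⟨q, hq⟩ := hsurj fun j => realMoment s (X ^ k * X ^ (j : ℕ))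
  have hdeg : (q : ℝ[X]).degree < k := mem_degreeLT.1 q.2
  refine ⟨X ^ k - (q : ℝ[X]), monic_X_pow_sub hdeg, ?_, fun j hj => ?_⟩
  · refine natDegree_eq_of_degree_eq_some ?_
    rw [degree_sub_eq_left_of_degree_lt (by rwa [degree_X_pow]), degree_X_pow]
  · have := congrFun hq ⟨j, hj⟩
    rw [hA] at this
    simp only at this
    rw [sub_mul, map_sub, this, sub_self]

theorem exists_isFirstKind {s : ℕ → ℝ} {n : ℕ} (hS : (hankel s n).PosDef) :
    ∃ P : ℕ → ℝ[X], IsFirstKind s n P := by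
  have hex : ∀ k, ∃ p : ℝ[X], k ≤ n + 1 →
      p.Monic ∧ p.natDegree = k ∧ ∀ j < k, realMoment s (p * X ^ j) = 0 := by
    intro k
    by_cases hk : k ≤ n + 1
    · obtain ⟨p, hp⟩ := exists_monic_orthogonal hS hk
      exact ⟨p, fun _ => hp⟩
    · exact ⟨0, fun h => absurd h hk⟩
  choose p hp using hex
  have horth : ∀ j k, j < k → k ≤ n + 1 → realMoment s (p j * p k) = 0 := by
    intro j k hjk hk
    conv_lhs =>
      enter [2, 1]
      rw [(p j).as_sum_range' k (by rw [(hp j (by omega)).2.1]; exact hjk)]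
    rw [Finset.sum_mul, map_sum]
    refine Finset.sum_eq_zero fun i hi => ?_
    rw [← C_mul_X_pow_eq_monomial, ← smul_eq_C_mul, smul_mul_assoc, map_smul, mul_comm,
      (hp k hk).2.2 i (Finset.mem_range.1 hi), smul_zero]
  have hpos : ∀ k ≤ n, 0 < realMoment s (p k * p k) := fun k hk =>
    realMoment_mul_self_pos hS (hp k (by omega)).1.ne_zero (by rw [(hp k (by omega)).2.1]; exact hk)
  -- Beyond n the square of `p k` involves moments outside the Hankel matrix, so its sign is not
  -- controlled and no normalisation is made.
  let c : ℕ → ℝ := fun k => if k ≤ n then (Real.sqrt (realMoment s (p k * p k)))⁻¹ else 1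
  have hc : ∀ k, 0 < c k := by
    intro k
    by_cases hk : k ≤ n
    · simpa [c, hk] using Real.sqrt_pos.2 (hpos k hk)
    · simp [c, hk]
  have hmul : ∀ j k, realMoment s (c j • p j * c k • p k) =
      c j * c k * realMoment s (p j * p k) := by
    intro j k
    rw [smul_mul_smul_comm, map_smul, smul_eq_mul]
  refine ⟨fun k => c k • p k, fun k hk => ?_, fun k hk => ?_, fun j hj k hk => ?_,
    fun j hj => ?_⟩
  · rw [natDegree_smul _ (hc k).ne', (hp k hk).2.1]
  · rw [leadingCoeff_smul_of_smul_regular _ (IsSMulRegular.of_ne_zero (hc k).ne'),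
      (hp k hk).1.leadingCoeff]
    simpa using hc k
  · rw [momentFunctional_map, hmul]
    rcases lt_trichotomy j k with h | rfl | h
    · simp [h.ne, horth j k h (by omega)]
    · have h1 := Real.mul_self_sqrt (hpos j hj).le
      have h2 := Real.sqrt_pos.2 (hpos j hj)
      have : c j * c j * realMoment s (p j * p j) = 1 := by
        simp only [c, hj, if_true]
        conv_lhs =>
          enter [2]
          rw [← h1]
        field_simp
      simp [this]
    · rw [mul_comm (p j)]
      simp [h.ne', horth k j h (by omega)]
  · rw [momentFunctional_map, hmul, horth j (n + 1) (by omega) le_rfl]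
    simp

namespace IsFirstKind

variable {s : ℕ → ℝ} {n : ℕ} {P : ℕ → ℝ[X]}

theorem ne_zero (hP : IsFirstKind s n P) {k : ℕ} (hk : k ≤ n + 1) : P k ≠ 0 := fun h => by
  have := hP.leadingCoeff_pos k hk
  simp [h] at this

theorem realMoment_mul (hP : IsFirstKind s n P) {j k : ℕ} (hj : j ≤ n) (hk : k ≤ n + 1) :
    realMoment s (P j * P k) = if j = k then 1 else 0 := by
  rcases (by omega : k ≤ n ∨ k = n + 1) with h | rfl
  · have := hP.orthonormal j hj k h
    rw [momentFunctional_map] at this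
    split_ifs at this ⊢ <;> exact_mod_cast this
  · have := hP.orthogonal j hj
    rw [momentFunctional_map] at this
    rw [if_neg (by omega)]
    exact_mod_cast this

/-- A polynomial orthogonal to `P_0, …, P_{d-1}` is orthogonal to all polynomials of degree less
than `d`. -/
theorem realMoment_mul_eq_zero (hP : IsFirstKind s n P) {r : ℝ[X]} {d : ℕ} (hd : d ≤ n + 2)
    (hr : ∀ j < d, realMoment s (P j * r) = 0) {q : ℝ[X]} (hq : q.degree < d) :
    realMoment s (q * r) = 0 := by
  induction d generalizing q with
  | zero =>
    have : q = 0 := by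
      rw [← degree_eq_bot]
      simpa using hq
    simp [this]
  | succ d ih =>
    have hlc := hP.leadingCoeff_pos d (by omega)
    have hnat := hP.natDegree_eq d (by omega)
    have hsub : (q - (q.coeff d / (P d).leadingCoeff) • P d).degree < d := by
      rw [degree_lt_iff_coeff_zero] at hq ⊢
      intro m hm
      rcases hm.eq_or_lt with rfl | hm
      · have : (P d).coeff d = (P d).leadingCoeff := by rw [leadingCoeff, hnat]
        rw [coeff_sub, coeff_smul, this, smul_eq_mul, div_mul_cancel₀ _ hlc.ne', sub_self]
      · rw [coeff_sub, coeff_smul, hq m (Nat.succ_le_of_lt hm), coeff_eq_zero_of_natDegree_lt (p := P d) (by omega)]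
        simp
    have h := ih (by omega) (fun j hj => hr j (by omega)) hsub
    rw [sub_mul, map_sub, smul_mul_assoc, map_smul, hr d (Nat.lt_succ_self d), smul_zero,
      sub_zero] at h
    exact h

theorem realMoment_mul_of_degree_lt (hP : IsFirstKind s n P) {k : ℕ} (hk : k ≤ n + 1) {q : ℝ[X]}
    (hq : q.degree < k) : realMoment s (q * P k) = 0 :=
  hP.realMoment_mul_eq_zero (by omega)
    (fun j hj => by rw [hP.realMoment_mul (by omega) hk, if_neg hj.ne]) hq

/-- The off-diagonal entries of the Jacobi matrix. -/
noncomputable def jacobiOff (P : ℕ → ℝ[X]) (k : ℕ) : ℝ :=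
  (P k).leadingCoeff / (P (k + 1)).leadingCoeff

theorem jacobiOff_pos (hP : IsFirstKind s n P) {k : ℕ} (hk : k ≤ n) : 0 < jacobiOff P k :=
  div_pos (hP.leadingCoeff_pos k (by omega)) (hP.leadingCoeff_pos (k + 1) (by omega))

theorem degree_X_mul_sub (hP : IsFirstKind s n P) {k : ℕ} (hk : k ≤ n) :
    (X * P k - jacobiOff P k • P (k + 1)).degree < ((k + 1 : ℕ) : WithBot ℕ) := by
  rw [degree_lt_iff_coeff_zero]
  intro m hm
  obtain ⟨m, rfl⟩ : ∃ m', m = m' + 1 := ⟨m - 1, by omega⟩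
  have h1 := hP.natDegree_eq k (by omega)
  have h2 := hP.natDegree_eq (k + 1) (by omega)
  rw [coeff_sub, coeff_X_mul, coeff_smul, smul_eq_mul]
  rcases (by omega : m = k ∨ k < m) with rfl | hm
  · have e1 : (P m).coeff m = (P m).leadingCoeff := by rw [leadingCoeff, h1]
    have e2 : (P (m + 1)).coeff (m + 1) = (P (m + 1)).leadingCoeff := by rw [leadingCoeff, h2]
    have := (hP.leadingCoeff_pos (m + 1) (by omega)).ne'
    rw [e1, e2, jacobiOff, div_mul_cancel₀ _ this, sub_self]
  · rw [coeff_eq_zero_of_natDegree_lt (by omega), coeff_eq_zero_of_natDegree_lt (by omega)]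
    simp

/-- The recurrences are proved by applying this to the difference of their two sides. -/
theorem eq_zero_of_orthogonal (hP : IsFirstKind s n P) (hS : (hankel s n).PosDef) {k : ℕ}
    (hk : k ≤ n) {r : ℝ[X]} (hdeg : r.degree < (k + 1 : ℕ))
    (hr : ∀ j < k + 1, realMoment s (P j * r) = 0) : r = 0 :=
  eq_zero_of_realMoment_mul_self hS
    (hdeg.trans_le (by exact_mod_cast Nat.succ_le_succ hk))
    (hP.realMoment_mul_eq_zero (by omega) hr hdeg)

theorem degree_eq (hP : IsFirstKind s n P) {k : ℕ} (hk : k ≤ n + 1) : (P k).degree = k := by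
  rw [degree_eq_natDegree (hP.ne_zero hk), hP.natDegree_eq k hk]

theorem realMoment_mul_X_mul (hP : IsFirstKind s n P) {j k : ℕ} (hk : k ≤ n) (hjk : j + 1 < k) :
    realMoment s (P j * (X * P k)) = 0 := by
  have : P j * (X * P k) = (X * P j) * P k := by ring
  rw [this]
  refine hP.realMoment_mul_of_degree_lt (by omega) ?_
  rw [degree_mul, degree_X, hP.degree_eq (by omega), add_comm]
  exact_mod_cast hjk

/-- X P_k is `jacobiOff P k` times P_{k+1} up to lower degree, and P_{k+1} has norm one. This makes
the Jacobi matrix symmetric. -/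
theorem realMoment_mul_X_mul_succ (hP : IsFirstKind s n P) {k : ℕ} (hk : k + 1 ≤ n) :
    realMoment s (P k * (X * P (k + 1))) = jacobiOff P k := by
  have : P k * (X * P (k + 1)) = (X * P k - jacobiOff P k • P (k + 1)) * P (k + 1) +
      jacobiOff P k • (P (k + 1) * P (k + 1)) := by
    rw [sub_mul, smul_mul_assoc]
    ring
  rw [this, map_add, hP.realMoment_mul_of_degree_lt (by omega)
    (hP.degree_X_mul_sub (by omega)), map_smul, hP.realMoment_mul hk (by omega)]
  simp

/-- The diagonal entries of the Jacobi matrix. -/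
noncomputable def jacobiDiag (s : ℕ → ℝ) (P : ℕ → ℝ[X]) (k : ℕ) : ℝ :=
  realMoment s (P k * (X * P k))

theorem X_mul_zero (hP : IsFirstKind s n P) (hS : (hankel s n).PosDef) :
    X * P 0 = jacobiOff P 0 • P 1 + jacobiDiag s P 0 • P 0 := by
  rw [← sub_eq_zero, ← sub_sub]
  refine hP.eq_zero_of_orthogonal hS (Nat.zero_le n) ?_ fun j hj => ?_
  · refine (degree_sub_le _ _).trans_lt (max_lt (hP.degree_X_mul_sub (Nat.zero_le n)) ?_)
    refine (degree_smul_le _ _).trans_lt ?_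
    rw [hP.degree_eq (Nat.zero_le _)]
    exact_mod_cast Nat.zero_lt_one
  · obtain rfl : j = 0 := by omega
    rw [mul_sub, mul_sub, mul_smul_comm, mul_smul_comm, map_sub, map_sub, map_smul, map_smul,
      hP.realMoment_mul (Nat.zero_le _) (by omega), hP.realMoment_mul (Nat.zero_le _) (by omega)]
    simp [jacobiDiag]

/-- In the last row, k + 1 = n, the scale of P_{n+1} is arbitrary. It is absorbed in `jacobiOff P
n`, and only the orthogonality of P_{n+1} is used. -/
theorem X_mul_succ (hP : IsFirstKind s n P) (hS : (hankel s n).PosDef) {k : ℕ} (hk : k + 1 ≤ n) :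
    X * P (k + 1) = jacobiOff P (k + 1) • P (k + 2) + jacobiDiag s P (k + 1) • P (k + 1) +
      jacobiOff P k • P k := by
  rw [← sub_eq_zero, ← sub_sub, ← sub_sub]
  refine hP.eq_zero_of_orthogonal hS hk ?_ fun j hj => ?_
  · refine (degree_sub_le _ _).trans_lt (max_lt ((degree_sub_le _ _).trans_lt
      (max_lt (hP.degree_X_mul_sub hk) ?_)) ?_)
    · refine (degree_smul_le _ _).trans_lt ?_
      rw [hP.degree_eq (by omega)]
      exact_mod_cast Nat.lt_succ_self _
    · refine (degree_smul_le _ _).trans_lt ?_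
      rw [hP.degree_eq (by omega)]
      exact_mod_cast (by omega : k < k + 1 + 1)
  · simp only [mul_sub, mul_smul_comm, map_sub, map_smul, smul_eq_mul]
    rw [hP.realMoment_mul (by omega) (by omega), hP.realMoment_mul (by omega) (by omega),
      hP.realMoment_mul (by omega) (by omega)]
    rcases (by omega : j + 1 < k + 1 ∨ j = k ∨ j = k + 1) with h | rfl | rfl
    · rw [hP.realMoment_mul_X_mul hk h, if_neg (by omega), if_neg (by omega), if_neg (by omega)]
      simp
    · rw [hP.realMoment_mul_X_mul_succ hk, if_neg (by omega), if_neg (by omega), if_pos rfl]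
      simp
    · rw [if_neg (by omega), if_pos rfl, if_neg (by omega)]
      simp [jacobiDiag]

end IsFirstKind
end Orthogonal

/-! ### Christoffel–Darboux identities and positivity of the formula. -/

section ChristoffelDarboux

/-- Cross-multiply the two recurrences and subtract: the diagonal terms cancel and the off-diagonal
ones telescope. The constants e and f allow for the inhomogeneous first row satisfied by the Q_k. -/
theorem christoffelDarboux {a b x y : ℕ → ℂ} {z w e f : ℂ} (n : ℕ)
    (hx0 : z * x 0 + e = b 0 * x 1 + a 0 * x 0) (hy0 : w * y 0 + f = b 0 * y 1 + a 0 * y 0)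
    (hx : ∀ k, k + 1 ≤ n →
      z * x (k + 1) = b (k + 1) * x (k + 2) + a (k + 1) * x (k + 1) + b k * x k)
    (hy : ∀ k, k + 1 ≤ n →
      w * y (k + 1) = b (k + 1) * y (k + 2) + a (k + 1) * y (k + 1) + b k * y k) :
    b n * (x (n + 1) * y n - x n * y (n + 1)) =
      (z - w) * ∑ k ∈ Finset.range (n + 1), x k * y k + (e * y 0 - f * x 0) := by
  induction n with
  | zero =>
    rw [Finset.sum_range_one]
    linear_combination (-y 0) * hx0 + x 0 * hy0
  | succ n ih =>
    have h := ih (fun k hk => hx k (by omega)) (fun k hk => hy k (by omega))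
    rw [Finset.sum_range_succ]
    linear_combination h - y (n + 1) * hx n le_rfl + x (n + 1) * hy n le_rfl

/-- The solution `α P_k(z) + β Q_k(z)` of the three-term recurrence. -/
noncomputable def recSol (s : ℕ → ℝ) (P : ℕ → ℝ[X]) (α β z : ℂ) (k : ℕ) : ℂ :=
  firstKind (P k) z * α + β * secondKind s (P k) z

theorem recSol_conj (s : ℕ → ℝ) (P : ℕ → ℝ[X]) (α β z : ℂ) (k : ℕ) :
    recSol s P (starRingEnd ℂ α) (starRingEnd ℂ β) (starRingEnd ℂ z) k =
      starRingEnd ℂ (recSol s P α β z k) := by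
  simp [recSol, firstKind_conj, secondKind_conj]

theorem firstKind_X_mul (P : ℝ[X]) (z : ℂ) : firstKind (X * P) z = z * firstKind P z := by
  simp [firstKind]

namespace IsFirstKind

variable {s : ℕ → ℝ} {n : ℕ} {P : ℕ → ℝ[X]}

theorem eq_C_zero (hP : IsFirstKind s n P) : P 0 = C (P 0).leadingCoeff := by
  have h := eq_C_of_natDegree_eq_zero (hP.natDegree_eq 0 (Nat.zero_le _))
  rw [leadingCoeff, hP.natDegree_eq 0 (Nat.zero_le _)]
  exact h

theorem secondKind_zero (hP : IsFirstKind s n P) (z : ℂ) : secondKind s (P 0) z = 0 := by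
  rw [hP.eq_C_zero, secondKind_C]

theorem realMoment_zero_mul (hP : IsFirstKind s n P) (z : ℂ) :
    (realMoment s (P 0) : ℂ) * firstKind (P 0) z = 1 := by
  have h1 := hP.realMoment_mul (Nat.zero_le n) (Nat.zero_le (n + 1))
  have h2 : firstKind (P 0) z = (P 0).leadingCoeff := by
    rw [hP.eq_C_zero, leadingCoeff_C]
    simp [firstKind]
  have h3 : realMoment s (P 0 * P 0) = (P 0).leadingCoeff * realMoment s (P 0) := by
    conv_lhs =>
      enter [2, 1]
      rw [hP.eq_C_zero]
    rw [← smul_eq_C_mul, map_smul, smul_eq_mul]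
  rw [h3, if_pos rfl] at h1
  rw [h2, mul_comm]
  exact_mod_cast h1

theorem realMoment_succ (hP : IsFirstKind s n P) {k : ℕ} (hk : k + 1 ≤ n + 1) :
    realMoment s (P (k + 1)) = 0 := by
  have := hP.realMoment_mul_of_degree_lt hk (q := 1) (by
    rw [degree_one]
    exact_mod_cast Nat.succ_pos k)
  rwa [one_mul] at this

theorem recSol_zero_rec (hP : IsFirstKind s n P) (hS : (hankel s n).PosDef) (α β z : ℂ) :
    z * recSol s P α β z 0 + β * realMoment s (P 0) =
      jacobiOff P 0 * recSol s P α β z 1 + jacobiDiag s P 0 * recSol s P α β z 0 := by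
  have h1 := congrArg (firstKindLinear z) (hP.X_mul_zero hS)
  have h2 := congrArg (secondKindLinear s z) (hP.X_mul_zero hS)
  simp only [map_add, map_smul, firstKindLinear_apply, secondKindLinear_apply, firstKind_X_mul,
    secondKind_X_mul, Complex.real_smul] at h1 h2
  simp only [recSol]
  linear_combination α * h1 + β * h2

theorem recSol_succ_rec (hP : IsFirstKind s n P) (hS : (hankel s n).PosDef) (α β z : ℂ) {k : ℕ}
    (hk : k + 1 ≤ n) :
    z * recSol s P α β z (k + 1) = jacobiOff P (k + 1) * recSol s P α β z (k + 2) +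
      jacobiDiag s P (k + 1) * recSol s P α β z (k + 1) + jacobiOff P k * recSol s P α β z k := by
  have h1 := congrArg (firstKindLinear z) (hP.X_mul_succ hS hk)
  have h2 := congrArg (secondKindLinear s z) (hP.X_mul_succ hS hk)
  simp only [map_add, map_smul, firstKindLinear_apply, secondKindLinear_apply, firstKind_X_mul,
    secondKind_X_mul, Complex.real_smul, hP.realMoment_succ (by omega : k + 1 ≤ n + 1),
    Complex.ofReal_zero, add_zero] at h1 h2
  simp only [recSol]
  linear_combination α * h1 + β * h2

/-- For w = z the sum disappears and the Wronskian is a constant; for w the conjugate of z and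
conjugate parameters the sum is one of squared moduli. -/
theorem recSol_wronskian (hP : IsFirstKind s n P) (hS : (hankel s n).PosDef) (α β z α' β' w : ℂ) :
    jacobiOff P n * (recSol s P α β z (n + 1) * recSol s P α' β' w n -
        recSol s P α β z n * recSol s P α' β' w (n + 1)) =
      (z - w) * ∑ k ∈ Finset.range (n + 1), recSol s P α β z k * recSol s P α' β' w k +
        (β * α' - β' * α) := by
  have h := christoffelDarboux (a := fun k => jacobiDiag s P k) (b := fun k => jacobiOff P k) n
    (hP.recSol_zero_rec hS α β z) (hP.recSol_zero_rec hS α' β' w)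
    (fun k hk => hP.recSol_succ_rec hS α β z hk) (fun k hk => hP.recSol_succ_rec hS α' β' w hk)
  rw [h]
  congr 1
  simp only [recSol, hP.secondKind_zero, mul_zero, add_zero]
  linear_combination β * α' * hP.realMoment_zero_mul w - β' * α * hP.realMoment_zero_mul z

theorem recSol_im (hP : IsFirstKind s n P) (hS : (hankel s n).PosDef) (α β z : ℂ) :
    jacobiOff P n * (recSol s P α β z (n + 1) * starRingEnd ℂ (recSol s P α β z n)).im =
      z.im * ∑ k ∈ Finset.range (n + 1), Complex.normSq (recSol s P α β z k) +
        (β * starRingEnd ℂ α).im := by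
  have h := hP.recSol_wronskian hS α β z (starRingEnd ℂ α) (starRingEnd ℂ β) (starRingEnd ℂ z)
  simp only [recSol_conj, Complex.mul_conj] at h
  rw [← Complex.ofReal_sum] at h
  have h' := congrArg Complex.im h
  generalize ∑ k ∈ Finset.range (n + 1), Complex.normSq (recSol s P α β z k) = S at h' ⊢
  simp only [Complex.add_im, Complex.sub_im, Complex.mul_im, Complex.mul_re, Complex.sub_re,
    Complex.ofReal_re, Complex.ofReal_im, Complex.conj_re, Complex.conj_im] at h' ⊢
  linear_combination h' / 2

theorem nevDenom_conj (P : ℕ → ℝ[X]) (n : ℕ) {τ : ℂ → ℂ} (hτ : IsNevanlinna τ) {z : ℂ}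
    (hz : z.im ≠ 0) :
    nevDenom P n τ (starRingEnd ℂ z) = starRingEnd ℂ (nevDenom P n τ z) := by
  simp [nevDenom, firstKind_conj, hτ.symm z hz]

theorem sum_normSq_firstKind_pos (hP : IsFirstKind s n P) (z : ℂ) :
    0 < ∑ k ∈ Finset.range (n + 1), Complex.normSq (firstKind (P k) z) := by
  refine Finset.sum_pos' (fun k _ => Complex.normSq_nonneg _)
    ⟨0, Finset.mem_range.2 (Nat.succ_pos n), Complex.normSq_pos.2 fun h => ?_⟩
  have := hP.realMoment_zero_mul z
  simp [h] at this

/-- At a zero w in the upper half-plane P_{n+1} = -P_n τ, and `recSol_im` for the P_k gives -b_n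
|P_n|² Im τ = Im w · Σ |P_k|² > 0, against Im τ ≥ 0. -/
theorem nevDenom_ne_zero (hP : IsFirstKind s n P) (hS : (hankel s n).PosDef) {τ : ℂ → ℂ}
    (hτ : IsNevanlinna τ) {z : ℂ} (hz : z.im ≠ 0) : nevDenom P n τ z ≠ 0 := by
  have key : ∀ w : ℂ, 0 < w.im → nevDenom P n τ w ≠ 0 := by
    intro w hw h
    have h1 := hP.recSol_im hS 1 0 w
    simp only [recSol, mul_one, zero_mul, add_zero, Complex.zero_im] at h1
    have h2 : firstKind (P (n + 1)) w = -(firstKind (P n) w * τ w) := by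
      rw [nevDenom] at h
      linear_combination h
    have h3 : (firstKind (P (n + 1)) w * starRingEnd ℂ (firstKind (P n) w)).im =
        -(Complex.normSq (firstKind (P n) w) * (τ w).im) := by
      rw [h2]
      simp [Complex.normSq_apply]
      ring
    rw [h3] at h1
    have h4 := mul_pos hw (hP.sum_normSq_firstKind_pos w)
    have h5 := mul_nonneg (hP.jacobiOff_pos le_rfl).le
      (mul_nonneg (Complex.normSq_nonneg (firstKind (P n) w)) (hτ.im_nonneg w hw))
    linarith
  rcases lt_or_gt_of_ne hz with h | h
  · intro h0
    refine key (starRingEnd ℂ z) (by simpa using h) ?_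
    rw [nevDenom_conj P n hτ hz, h0, map_zero]
  · exact key z h

end IsFirstKind

/-- The linear form of the formula, which can be solved for τ as well as for φ. -/
theorem eq_nevFormula_iff {s : ℕ → ℝ} {P : ℕ → ℝ[X]} {n : ℕ} {τ : ℂ → ℂ} {z φ : ℂ}
    (h : nevDenom P n τ z ≠ 0) :
    φ = nevFormula s P n τ z ↔ recSol s P φ 1 z n * τ z + recSol s P φ 1 z (n + 1) = 0 := by
  rw [nevFormula, ← neg_div, eq_div_iff h, nevDenom, recSol, recSol]
  constructor
  · intro h
    linear_combination h
  · intro h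
    linear_combination h

namespace IsFirstKind

variable {s : ℕ → ℝ} {n : ℕ} {P : ℕ → ℝ[X]}

/-- Otherwise two consecutive terms vanish, and so does the Wronskian with the solution P_k, which
is a nonzero constant. -/
theorem recSol_ne_zero (hP : IsFirstKind s n P) (hS : (hankel s n).PosDef) {φ z t : ℂ}
    (h : recSol s P φ 1 z n * t + recSol s P φ 1 z (n + 1) = 0) : recSol s P φ 1 z n ≠ 0 := by
  intro h0
  have h1 : recSol s P φ 1 z (n + 1) = 0 := by simpa [h0] using h
  have h2 := hP.recSol_wronskian hS φ 1 z 1 0 z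
  simp [h0, h1] at h2

theorem nevFormula_injective (hP : IsFirstKind s n P) (hS : (hankel s n).PosDef) {τ₁ τ₂ : ℂ → ℂ}
    (h₁ : IsNevanlinna τ₁) (h₂ : IsNevanlinna τ₂) {z : ℂ} (hz : z.im ≠ 0)
    (h : nevFormula s P n τ₁ z = nevFormula s P n τ₂ z) : τ₁ z = τ₂ z := by
  have e₁ := (eq_nevFormula_iff (s := s) (hP.nevDenom_ne_zero hS h₁ hz)).1 rfl
  have e₂ := (eq_nevFormula_iff (hP.nevDenom_ne_zero hS h₂ hz)).1 h
  exact mul_left_cancel₀ (hP.recSol_ne_zero hS e₁) (by linear_combination e₁ - e₂)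

/-- The identity that transfers positivity: from τ to φ directly, and from φ to τ once Bessel's
inequality bounds the sum. -/
theorem mul_im_eq (hP : IsFirstKind s n P) (hS : (hankel s n).PosDef) {φ z t : ℂ}
    (h : recSol s P φ 1 z n * t + recSol s P φ 1 z (n + 1) = 0) :
    jacobiOff P n * (Complex.normSq (recSol s P φ 1 z n) * t.im) =
      φ.im - z.im * ∑ k ∈ Finset.range (n + 1), Complex.normSq (recSol s P φ 1 z k) := by
  have h1 := hP.recSol_im hS φ 1 z
  have h2 : recSol s P φ 1 z (n + 1) = -(recSol s P φ 1 z n * t) := by linear_combination h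
  have h3 : (recSol s P φ 1 z (n + 1) * starRingEnd ℂ (recSol s P φ 1 z n)).im =
      -(Complex.normSq (recSol s P φ 1 z n) * t.im) := by
    rw [h2]
    simp [Complex.normSq_apply]
    ring
  rw [h3] at h1
  simp only [one_mul, Complex.conj_im] at h1
  linear_combination -h1

end IsFirstKind

theorem firstKind_differentiable (P : ℝ[X]) : Differentiable ℂ (firstKind P) :=
  Polynomial.differentiable _

theorem secondKind_differentiable (s : ℕ → ℝ) (P : ℝ[X]) : Differentiable ℂ (secondKind s P) := by
  induction P using Polynomial.induction_on' with
  | add p q hp hq =>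
    rw [show secondKind s (p + q) = fun z => secondKind s p z + secondKind s q z from
      funext (secondKind_add s p q)]
    exact hp.add hq
  | monomial i a =>
    rw [show secondKind s (monomial i a) = fun z => (a : ℂ) * secondKind s (X ^ i) z from
      funext fun z => by rw [← C_mul_X_pow_eq_monomial, ← smul_eq_C_mul, secondKind_smul]]
    refine Differentiable.const_mul ?_ _
    induction i with
    | zero =>
      rw [show secondKind s (X ^ 0) = fun _ => 0 from
        funext fun z => by rw [pow_zero, ← C_1, secondKind_C]]
      exact differentiable_const _
    | succ i ih =>
      rw [show secondKind s (X ^ (i + 1)) = fun z => z * secondKind s (X ^ i) z + s i from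
        funext (secondKind_X_pow_succ s i)]
      exact (differentiable_id.mul ih).add_const _

namespace IsFirstKind

variable {s : ℕ → ℝ} {n : ℕ} {P : ℕ → ℝ[X]}

/-- The Nevanlinna formula maps Nevanlinna functions to Nevanlinna functions. -/
theorem isNevanlinna_nevFormula (hP : IsFirstKind s n P) (hS : (hankel s n).PosDef) {τ : ℂ → ℂ}
    (hτ : IsNevanlinna τ) : IsNevanlinna (nevFormula s P n τ) where
  holo := by
    have h1 := fun k => (firstKind_differentiable (P k)).differentiableOn (s := {z : ℂ | z.im ≠ 0})
    have h2 := fun k =>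
      (secondKind_differentiable s (P k)).differentiableOn (s := {z : ℂ | z.im ≠ 0})
    exact ((((h2 n).mul hτ.holo).add (h2 (n + 1))).div (((h1 n).mul hτ.holo).add (h1 (n + 1)))
      fun z hz => hP.nevDenom_ne_zero hS hτ hz).neg
  symm z hz := by
    simp [nevFormula, nevDenom_conj P n hτ hz, secondKind_conj, hτ.symm z hz]
  im_nonneg z hz := by
    have h := hP.mul_im_eq hS ((eq_nevFormula_iff (hP.nevDenom_ne_zero hS hτ hz.ne')).1 rfl)
    have h1 : 0 ≤ z.im * ∑ k ∈ Finset.range (n + 1),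
        Complex.normSq (recSol s P (nevFormula s P n τ z) 1 z k) :=
      mul_nonneg hz.le (Finset.sum_nonneg fun k _ => Complex.normSq_nonneg _)
    have h2 := mul_nonneg (hP.jacobiOff_pos le_rfl).le
      (mul_nonneg (Complex.normSq_nonneg (recSol s P (nevFormula s P n τ z) 1 z n))
        (hτ.im_nonneg z hz))
    linarith

end IsFirstKind

end ChristoffelDarboux

/-! ### Bessel's inequality and positivity of the parameter. -/

section Bessel

theorem recSol_stieltjes {μ : Measure ℝ} [IsFiniteMeasure μ] {s : ℕ → ℝ} {l : ℕ}
    (hμ : IsMomentSolution s l μ) {P : ℕ → ℝ[X]} {k : ℕ} (hk : (P k).natDegree ≤ l) {z : ℂ}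
    (hz : z.im ≠ 0) :
    recSol s P (stieltjes μ z) 1 z k = ∫ t : ℝ, (((P k).eval t : ℝ) : ℂ) / ((t : ℂ) - z) ∂μ := by
  rw [recSol, one_mul, (firstKind_mul_stieltjes_add hμ hk hz).2]

namespace IsFirstKind

variable {s : ℕ → ℝ} {n : ℕ} {P : ℕ → ℝ[X]} {μ : Measure ℝ}

theorem integral_mul (hP : IsFirstKind s n P) (hμ : IsMomentSolution s (2 * n) μ) {j k : ℕ}
    (hj : j ≤ n) (hk : k ≤ n) :
    Integrable (fun t : ℝ => (P j).eval t * (P k).eval t) μ ∧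
      ∫ t, (P j).eval t * (P k).eval t ∂μ = if j = k then 1 else 0 := by
  have h := integral_eval hμ (P := P j * P k) (natDegree_mul_le.trans (by
    rw [hP.natDegree_eq j (by omega), hP.natDegree_eq k (by omega)]; omega))
  rw [hP.realMoment_mul hj (by omega)] at h
  simpa only [eval_mul] using h

variable [IsFiniteMeasure μ]

theorem integrable_eval_div (hP : IsFirstKind s n P) (hμ : IsMomentSolution s (2 * n) μ) {k : ℕ}
    (hk : k ≤ n) {z : ℂ} (hz : z.im ≠ 0) :
    Integrable (fun t : ℝ => (((P k).eval t : ℝ) : ℂ) / ((t : ℂ) - z)) μ :=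
  (firstKind_mul_stieltjes_add hμ (by rw [hP.natDegree_eq k (by omega)]; omega) hz).1

/-- Bessel's inequality for the function `t ↦ 1 / (t - z)`. -/
theorem bessel (hP : IsFirstKind s n P) (hμ : IsMomentSolution s (2 * n) μ) {z : ℂ}
    (hz : 0 < z.im) :
    z.im * ∑ k ∈ Finset.range (n + 1), Complex.normSq (recSol s P (stieltjes μ z) 1 z k) ≤
      (stieltjes μ z).im := by
  set c : ℕ → ℂ := recSol s P (stieltjes μ z) 1 z
  have hc : ∀ k ≤ n, c k = ∫ t : ℝ, (((P k).eval t : ℝ) : ℂ) / ((t : ℂ) - z) ∂μ := fun k hk =>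
    recSol_stieltjes hμ (by rw [hP.natDegree_eq k (by omega)]; omega) hz.ne'
  have hle : ∀ k ∈ Finset.range (n + 1), k ≤ n := fun k hk => Nat.lt_succ_iff.1 (by simpa using hk)
  -- the three parts of the square
  have hg : Integrable (fun t : ℝ => Complex.normSq (1 / ((t : ℂ) - z))) μ := by
    refine Integrable.of_bound (C := (1 / |z.im|) ^ 2)
      (Complex.continuous_normSq.comp
        (continuous_one_div_ofReal_sub hz.ne')).aestronglyMeasurable (ae_of_all _ fun t => ?_)
    rw [Real.norm_of_nonneg (Complex.normSq_nonneg _), Complex.normSq_eq_norm_sq]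
    exact pow_le_pow_left₀ (norm_nonneg _) (norm_one_div_ofReal_sub_le hz.ne' t) 2
  -- Im z · |1/(t - z)|² = Im (1/(t - z)) turns the squared L²-norm into the imaginary part of the
  -- transform.
  have hgi : z.im * ∫ t : ℝ, Complex.normSq (1 / ((t : ℂ) - z)) ∂μ = (stieltjes μ z).im := by
    rw [stieltjes_im μ hz.ne', ← integral_const_mul]
    refine integral_congr_ae (ae_of_all _ fun t => ?_)
    simp [div_eq_mul_inv]
  have hcross : ∀ k ∈ Finset.range (n + 1), Integrable (fun t : ℝ =>
      starRingEnd ℂ (c k) * ((((P k).eval t : ℝ) : ℂ) / ((t : ℂ) - z))) μ := fun k hk =>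
    (hP.integrable_eval_div hμ (hle k hk) hz.ne').const_mul _
  have hcrossi : ∫ t : ℝ, ∑ k ∈ Finset.range (n + 1),
      starRingEnd ℂ (c k) * ((((P k).eval t : ℝ) : ℂ) / ((t : ℂ) - z)) ∂μ =
        ((∑ k ∈ Finset.range (n + 1), Complex.normSq (c k) : ℝ) : ℂ) := by
    rw [integral_finsetSum _ hcross, Complex.ofReal_sum]
    refine Finset.sum_congr rfl fun k hk => ?_
    rw [integral_const_mul, ← hc k (hle k hk), mul_comm, Complex.mul_conj]
  have hsq : ∀ j ∈ Finset.range (n + 1), ∀ k ∈ Finset.range (n + 1), Integrable (fun t : ℝ =>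
      (c j * starRingEnd ℂ (c k)).re * ((P j).eval t * (P k).eval t)) μ := fun j hj k hk =>
    (hP.integral_mul hμ (hle j hj) (hle k hk)).1.const_mul _
  have hsqi : ∫ t : ℝ, ∑ j ∈ Finset.range (n + 1), ∑ k ∈ Finset.range (n + 1),
      (c j * starRingEnd ℂ (c k)).re * ((P j).eval t * (P k).eval t) ∂μ =
        ∑ k ∈ Finset.range (n + 1), Complex.normSq (c k) := by
    rw [integral_finsetSum _ fun j hj => integrable_finsetSum _ (hsq j hj)]
    refine Finset.sum_congr rfl fun j hj => ?_
    rw [integral_finsetSum _ (hsq j hj), Finset.sum_eq_single_of_mem j hj]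
    · rw [integral_const_mul, (hP.integral_mul hμ (hle j hj) (hle j hj)).2, if_pos rfl, mul_one,
        Complex.mul_conj, Complex.ofReal_re]
    · intro k hk hkj
      rw [integral_const_mul, (hP.integral_mul hμ (hle j hj) (hle k hk)).2, if_neg hkj.symm,
        mul_zero]
  have hexp : ∀ t : ℝ, Complex.normSq (1 / ((t : ℂ) - z) -
      ∑ k ∈ Finset.range (n + 1), c k * (((P k).eval t : ℝ) : ℂ)) =
      Complex.normSq (1 / ((t : ℂ) - z)) - 2 * (∑ k ∈ Finset.range (n + 1),
        starRingEnd ℂ (c k) * ((((P k).eval t : ℝ) : ℂ) / ((t : ℂ) - z))).re +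
      ∑ j ∈ Finset.range (n + 1), ∑ k ∈ Finset.range (n + 1),
        (c j * starRingEnd ℂ (c k)).re * ((P j).eval t * (P k).eval t) := by
    intro t
    have e1 : ∑ k ∈ Finset.range (n + 1),
        starRingEnd ℂ (c k) * ((((P k).eval t : ℝ) : ℂ) / ((t : ℂ) - z)) =
        (1 / ((t : ℂ) - z)) *
          starRingEnd ℂ (∑ k ∈ Finset.range (n + 1), c k * (((P k).eval t : ℝ) : ℂ)) := by
      rw [map_sum, Finset.mul_sum]
      refine Finset.sum_congr rfl fun k _ => ?_
      rw [map_mul, Complex.conj_ofReal]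
      ring
    have e2 : ∑ j ∈ Finset.range (n + 1), ∑ k ∈ Finset.range (n + 1),
        (c j * starRingEnd ℂ (c k)).re * ((P j).eval t * (P k).eval t) =
        Complex.normSq (∑ k ∈ Finset.range (n + 1), c k * (((P k).eval t : ℝ) : ℂ)) := by
      rw [← Complex.ofReal_re (Complex.normSq _), ← Complex.mul_conj, map_sum,
        Finset.sum_mul_sum, Complex.re_sum]
      refine Finset.sum_congr rfl fun j _ => ?_
      rw [Complex.re_sum]
      refine Finset.sum_congr rfl fun k _ => ?_
      rw [map_mul, Complex.conj_ofReal, ← Complex.re_mul_ofReal]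
      congr 1
      push_cast
      ring
    rw [e1, e2, Complex.normSq_sub]
    ring
  have hre : Integrable (fun t : ℝ => (∑ k ∈ Finset.range (n + 1),
      starRingEnd ℂ (c k) * ((((P k).eval t : ℝ) : ℂ) / ((t : ℂ) - z))).re) μ :=
    (integrable_finsetSum _ hcross).re
  have hdiff : Integrable (fun t : ℝ => Complex.normSq (1 / ((t : ℂ) - z)) -
      2 * (∑ k ∈ Finset.range (n + 1),
        starRingEnd ℂ (c k) * ((((P k).eval t : ℝ) : ℂ) / ((t : ℂ) - z))).re) μ :=
    hg.sub (hre.const_mul 2)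
  have hrei : ∫ t : ℝ, (∑ k ∈ Finset.range (n + 1),
      starRingEnd ℂ (c k) * ((((P k).eval t : ℝ) : ℂ) / ((t : ℂ) - z))).re ∂μ =
        ∑ k ∈ Finset.range (n + 1), Complex.normSq (c k) := by
    refine (integral_re (integrable_finsetSum _ hcross)).trans ?_
    rw [hcrossi]
    exact Complex.ofReal_re _
  -- By orthonormality this integral is ∫ |1/(t - z)|² dμ - 2 Σ |c_k|² + Σ |c_k|².
  have hnonneg : 0 ≤ ∫ t : ℝ, Complex.normSq (1 / ((t : ℂ) - z) -
      ∑ k ∈ Finset.range (n + 1), c k * (((P k).eval t : ℝ) : ℂ)) ∂μ :=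
    integral_nonneg fun t => Complex.normSq_nonneg _
  simp only [hexp] at hnonneg
  rw [integral_add hdiff
    (integrable_finsetSum _ fun j hj => integrable_finsetSum _ (hsq j hj)),
    integral_sub hg (hre.const_mul 2), integral_const_mul, hsqi, hrei] at hnonneg
  rw [← hgi]
  refine mul_le_mul_of_nonneg_left ?_ hz.le
  linarith

/-- Each multiplication by X adds the functional of X^i P_n, which is zero for i < n; hence the
bound i ≤ n. -/
theorem recSol_X_pow_mul (hP : IsFirstKind s n P) (φ z : ℂ) {i : ℕ} (hi : i ≤ n) :
    firstKind (X ^ i * P n) z * φ + secondKind s (X ^ i * P n) z =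
      z ^ i * recSol s P φ 1 z n := by
  induction i with
  | zero => simp [recSol]
  | succ i ih =>
    have h0 : realMoment s (X ^ i * P n) = 0 :=
      hP.realMoment_mul_of_degree_lt (by omega) (by
        rw [degree_X_pow]
        exact_mod_cast hi)
    rw [pow_succ', mul_assoc, firstKind_X_mul, secondKind_X_mul, h0, pow_succ',
      Complex.ofReal_zero]
    linear_combination z * ih (by omega)

theorem recSol_mul_self (hP : IsFirstKind s n P) (φ z : ℂ) :
    firstKind (P n * P n) z * φ + secondKind s (P n * P n) z =
      firstKind (P n) z * recSol s P φ 1 z n := by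
  have hP' : P n = ∑ i ∈ Finset.range (n + 1), (P n).coeff i • (X ^ i : ℝ[X]) := by
    conv_lhs => rw [(P n).as_sum_range' (n + 1) (by rw [hP.natDegree_eq n (by omega)]; omega)]
    exact Finset.sum_congr rfl fun i _ => by rw [smul_eq_C_mul, C_mul_X_pow_eq_monomial]
  have h1 : P n * P n = ∑ i ∈ Finset.range (n + 1), (P n).coeff i • (X ^ i * P n : ℝ[X]) := by
    conv_lhs =>
      enter [1]
      rw [hP']
    rw [Finset.sum_mul]
    exact Finset.sum_congr rfl fun i _ => smul_mul_assoc _ _ _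
  have h2 : firstKind (P n) z = ∑ i ∈ Finset.range (n + 1), ((P n).coeff i : ℂ) * z ^ i := by
    rw [← firstKindLinear_apply, hP', map_sum, ← hP']
    refine Finset.sum_congr rfl fun i _ => ?_
    rw [map_smul, firstKindLinear_apply, firstKind_X_pow, Complex.real_smul]
  rw [← firstKindLinear_apply, ← secondKindLinear_apply, h1, h2, map_sum, map_sum,
    Finset.sum_mul, Finset.sum_mul, ← Finset.sum_add_distrib]
  refine Finset.sum_congr rfl fun i hi => ?_
  rw [map_smul, map_smul, firstKindLinear_apply, secondKindLinear_apply, Complex.real_smul,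
    Complex.real_smul]
  linear_combination ((P n).coeff i : ℂ) *
    hP.recSol_X_pow_mul φ z (Nat.lt_succ_iff.1 (Finset.mem_range.1 hi))

/-- By `recSol_mul_self`, P_n(z) c_n(z) = ∫ P_n(t)² / (t - z) dμ(t). If c_n(z) = 0, the imaginary
part of this integral forces P_n = 0 almost everywhere, but P_n has norm one. -/
theorem recSol_stieltjes_ne_zero (hP : IsFirstKind s n P) (hμ : IsMomentSolution s (2 * n) μ)
    {z : ℂ} (hz : z.im ≠ 0) : recSol s P (stieltjes μ z) 1 z n ≠ 0 := by
  intro h0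
  have hdeg : (P n * P n).natDegree ≤ 2 * n := natDegree_mul_le.trans (by
    rw [hP.natDegree_eq n (by omega)]; omega)
  have h1 := firstKind_mul_stieltjes_add hμ hdeg hz
  rw [hP.recSol_mul_self, h0, mul_zero] at h1
  have h2 : ∫ t : ℝ, (P n * P n).eval t / Complex.normSq ((t : ℂ) - z) ∂μ = 0 := by
    have h3 := integral_im h1.1
    rw [← h1.2] at h3
    have h4 : ∫ t : ℝ, z.im * ((P n * P n).eval t / Complex.normSq ((t : ℂ) - z)) ∂μ = 0 := by
      refine Eq.trans (integral_congr_ae (ae_of_all _ fun t => ?_)) (h3.trans (by simp))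
      have := one_div_ofReal_sub_im z t
      change z.im * ((P n * P n).eval t / Complex.normSq ((t : ℂ) - z)) =
        ((((P n * P n).eval t : ℝ) : ℂ) / ((t : ℂ) - z)).im
      rw [div_eq_mul_one_div (((eval t (P n * P n) : ℝ) : ℂ)), Complex.im_ofReal_mul, this]
      ring
    rw [integral_const_mul] at h4
    exact (mul_eq_zero.1 h4).resolve_left hz
  have hnn : ∀ t : ℝ, 0 ≤ (P n * P n).eval t / Complex.normSq ((t : ℂ) - z) := fun t => by
    rw [eval_mul]
    exact div_nonneg (mul_self_nonneg _) (Complex.normSq_nonneg _)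
  have hint : Integrable (fun t : ℝ => (P n * P n).eval t / Complex.normSq ((t : ℂ) - z)) μ := by
    have := (h1.1.im).const_mul z.im⁻¹
    refine this.congr (ae_of_all _ fun t => ?_)
    have := one_div_ofReal_sub_im z t
    change z.im⁻¹ * ((((P n * P n).eval t : ℝ) : ℂ) / ((t : ℂ) - z)).im =
      (P n * P n).eval t / Complex.normSq ((t : ℂ) - z)
    rw [div_eq_mul_one_div (((eval t (P n * P n) : ℝ) : ℂ)), Complex.im_ofReal_mul, this]
    field_simp
  have h5 := (integral_eq_zero_iff_of_nonneg hnn hint).1 h2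
  have h6 : ∫ t, (P n).eval t * (P n).eval t ∂μ = 0 := by
    refine (integral_congr_ae ?_).trans (integral_zero ℝ ℝ)
    filter_upwards [h5] with t ht
    have hne : Complex.normSq ((t : ℂ) - z) ≠ 0 :=
      (Complex.normSq_pos.2 (ofReal_sub_ne_zero hz t)).ne'
    rw [← eval_mul]
    simpa [hne] using ht
  rw [(hP.integral_mul hμ le_rfl le_rfl).2, if_pos rfl] at h6
  exact one_ne_zero h6

/-- The parameter of the Stieltjes transform of a measure with the right moments is a Nevanlinna
function. -/
theorem isNevanlinna_parameter (hP : IsFirstKind s n P) (hS : (hankel s n).PosDef)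
    (hμ : IsMomentSolution s (2 * n) μ) :
    IsNevanlinna fun z => -(recSol s P (stieltjes μ z) 1 z (n + 1) /
      recSol s P (stieltjes μ z) 1 z n) where
  holo := by
    have h : ∀ k, DifferentiableOn ℂ (fun z => recSol s P (stieltjes μ z) 1 z k)
        {z : ℂ | z.im ≠ 0} := fun k =>
      ((firstKind_differentiable (P k)).differentiableOn.mul (isNevanlinna_stieltjes μ).holo).add
        ((secondKind_differentiable s (P k)).differentiableOn.const_mul 1)
    exact ((h (n + 1)).div (h n) fun z hz => hP.recSol_stieltjes_ne_zero hμ hz).neg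
  symm z hz := by
    have h : ∀ k, recSol s P (stieltjes μ (starRingEnd ℂ z)) 1 (starRingEnd ℂ z) k =
        starRingEnd ℂ (recSol s P (stieltjes μ z) 1 z k) := fun k => by
      rw [← recSol_conj, (isNevanlinna_stieltjes μ).symm z hz, map_one]
    rw [h, h, map_neg, map_div₀]
  im_nonneg z hz := by
    have h0 := hP.recSol_stieltjes_ne_zero hμ hz.ne'
    have h := hP.mul_im_eq hS (φ := stieltjes μ z) (z := z)
      (t := -(recSol s P (stieltjes μ z) 1 z (n + 1) / recSol s P (stieltjes μ z) 1 z n)) (by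
        field_simp
        ring)
    have h1 := hP.bessel hμ hz
    by_contra hlt
    have h2 := mul_pos (hP.jacobiOff_pos le_rfl)
      (mul_pos (Complex.normSq_pos.2 h0) (neg_pos.2 (not_le.1 hlt)))
    linarith

end IsFirstKind
end Bessel

/-! ### The coefficients of the formula at infinity. -/

section Asymptotics

theorem isBigO_inv_pow_cobounded (k : ℕ) :
    (fun z : ℂ => (z⁻¹) ^ (k + 1)) =O[Bornology.cobounded ℂ] fun z => z⁻¹ := by
  have h : (fun z : ℂ => (z⁻¹) ^ k) =O[Bornology.cobounded ℂ] fun _ => (1 : ℂ) :=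
    ((tendsto_inv₀_cobounded (α := ℂ)).pow k).isBigO_one ℂ
  simpa [pow_succ] using h.mul (isBigO_refl (fun z : ℂ => z⁻¹) _)

theorem isBigO_pow_div_pow_cobounded {i k : ℕ} (h : i < k) :
    (fun z : ℂ => z ^ i / z ^ k) =O[Bornology.cobounded ℂ] fun z => z⁻¹ := by
  refine (isBigO_inv_pow_cobounded (k - i - 1)).congr' ?_ EventuallyEq.rfl
  filter_upwards [Bornology.eventually_ne_cobounded (0 : ℂ)] with z hz
  have e : k = i + (k - i - 1 + 1) := by omega
  conv_rhs => rw [e, pow_add]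
  rw [inv_pow]
  field_simp

theorem firstKind_eq_sum {P : ℝ[X]} {k : ℕ} (hP : P.natDegree ≤ k) (z : ℂ) :
    firstKind P z = ∑ i ∈ Finset.range (k + 1), (P.coeff i : ℂ) * z ^ i := by
  rw [firstKind, eval_eq_sum_range' (n := k + 1)
    (natDegree_map_le.trans_lt (Nat.lt_succ_of_le hP))]
  simp

/-- The leading behaviour of a polynomial at `∞`. -/
theorem firstKind_div_pow_sub_isBigO {P : ℝ[X]} {k : ℕ} (hP : P.natDegree ≤ k) :
    (fun z => firstKind P z / z ^ k - P.coeff k) =O[Bornology.cobounded ℂ] fun z => z⁻¹ := by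
  have h : (fun z : ℂ => ∑ i ∈ Finset.range k, (P.coeff i : ℂ) * (z ^ i / z ^ k))
      =O[Bornology.cobounded ℂ] fun z => z⁻¹ :=
    IsBigO.fun_sum fun i hi =>
      (isBigO_pow_div_pow_cobounded (Finset.mem_range.1 hi)).const_mul_left _
  refine h.congr' ?_ EventuallyEq.rfl
  filter_upwards [Bornology.eventually_ne_cobounded (0 : ℂ)] with z hz
  have hk : z ^ k ≠ 0 := pow_ne_zero k hz
  rw [firstKind_eq_sum hP, Finset.sum_range_succ, add_div, mul_div_cancel_right₀ _ hk,
    add_sub_cancel_right, Finset.sum_div]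
  exact Finset.sum_congr rfl fun i _ => (mul_div_assoc _ _ _).symm

/-- The sum `s_0/z + ⋯ + s_{N-1}/z^N`. -/
noncomputable def momentSum (s : ℕ → ℝ) (N : ℕ) (z : ℂ) : ℂ :=
  ∑ j ∈ Finset.range N, (s j : ℂ) / z ^ (j + 1)

/-- The second-kind polynomial of X^i is the polynomial part of z^i times the moment sum, so the
shifted sum of negative powers is left. -/
theorem pow_mul_momentSum_sub (s : ℕ → ℝ) {N i : ℕ} (hi : i ≤ N) {z : ℂ} (hz : z ≠ 0) :
    firstKind (X ^ i) z * momentSum s N z - secondKind s (X ^ i) z =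
      ∑ l ∈ Finset.range (N - i), (s (i + l) : ℂ) / z ^ (l + 1) := by
  induction i with
  | zero =>
    have : secondKind s (X ^ 0) z = 0 := by rw [pow_zero, ← C_1, secondKind_C]
    rw [this, firstKind_X_pow]
    simp [momentSum]
  | succ i ih =>
    have h := ih (by omega)
    rw [show N - i = N - (i + 1) + 1 by omega, Finset.sum_range_succ'] at h
    rw [secondKind_X_pow_succ, firstKind_X_pow]
    rw [firstKind_X_pow] at h
    have e : ∑ l ∈ Finset.range (N - (i + 1)), (s (i + 1 + l) : ℂ) / z ^ (l + 1) =
        z * ∑ l ∈ Finset.range (N - (i + 1)), (s (i + (l + 1)) : ℂ) / z ^ (l + 1 + 1) := by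
      rw [Finset.mul_sum]
      refine Finset.sum_congr rfl fun l _ => ?_
      rw [show i + 1 + l = i + (l + 1) by ring]
      field_simp
      ring
    rw [e]
    simp only [zero_add, pow_one, add_zero] at h
    have h' : z * ((s i : ℂ) / z) = s i := by field_simp
    linear_combination z * h + h'

/-- The expansion of `P(z) T(z) - Q(z)` at `∞`, for `T` the sum of the first terms of the moment
series and `P` orthogonal to the powers below `m`. -/
theorem pow_mul_firstKind_momentSum_sub_isBigO {s : ℕ → ℝ} {N d m : ℕ} {P : ℝ[X]}
    (hd : P.natDegree ≤ d) (hN : d + m + 1 ≤ N)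
    (h0 : ∀ l < m, realMoment s (P * X ^ l) = 0) :
    (fun z => z ^ (m + 1) * (firstKind P z * momentSum s N z - secondKind s P z) -
      realMoment s (P * X ^ m)) =O[Bornology.cobounded ℂ] fun z => z⁻¹ := by
  -- Here l numbers the power z^{-(l+1)}. Terms with l < m cancel by orthogonality, l = m gives the
  -- constant, and l > m decays. The bound on N ensures that l = m occurs for every i ≤ d.
  have hX : ∀ i ∈ Finset.range (d + 1), (fun z => (P.coeff i : ℂ) *
      ∑ l ∈ Finset.Ico (m + 1) (N - i), (s (i + l) : ℂ) * (z ^ (m + 1) / z ^ (l + 1)))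
      =O[Bornology.cobounded ℂ] fun z => z⁻¹ := fun i _ =>
    (IsBigO.fun_sum fun l hl => (isBigO_pow_div_pow_cobounded (by
      have := (Finset.mem_Ico.1 hl).1
      omega)).const_mul_left _).const_mul_left _
  refine (IsBigO.fun_sum hX).congr' ?_ EventuallyEq.rfl
  filter_upwards [Bornology.eventually_ne_cobounded (0 : ℂ)] with z hz
  have hP' : P = ∑ i ∈ Finset.range (d + 1), P.coeff i • (X ^ i : ℝ[X]) := by
    conv_lhs => rw [P.as_sum_range' (d + 1) (Nat.lt_succ_of_le hd)]
    exact Finset.sum_congr rfl fun i _ => by rw [smul_eq_C_mul, C_mul_X_pow_eq_monomial]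
  have h1 : firstKind P z * momentSum s N z - secondKind s P z =
      ∑ i ∈ Finset.range (d + 1), (P.coeff i : ℂ) *
        (firstKind (X ^ i) z * momentSum s N z - secondKind s (X ^ i) z) := by
    rw [← firstKindLinear_apply, ← secondKindLinear_apply]
    conv_lhs => rw [hP']
    rw [map_sum, map_sum, Finset.sum_mul, ← Finset.sum_sub_distrib]
    refine Finset.sum_congr rfl fun i _ => ?_
    rw [map_smul, map_smul, firstKindLinear_apply, secondKindLinear_apply, Complex.real_smul,
      Complex.real_smul]
    ring
  have h2 : ∀ l, realMoment s (P * X ^ l) =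
      ∑ i ∈ Finset.range (d + 1), P.coeff i * s (i + l) := by
    intro l
    conv_lhs => rw [hP']
    rw [Finset.sum_mul, map_sum]
    refine Finset.sum_congr rfl fun i _ => ?_
    rw [smul_mul_assoc, map_smul, ← pow_add, realMoment_X_pow, smul_eq_mul]
  have h3 : (realMoment s (P * X ^ m) : ℂ) = ∑ l ∈ Finset.range (m + 1),
      (realMoment s (P * X ^ l) : ℂ) * (z ^ (m + 1) / z ^ (l + 1)) := by
    rw [Finset.sum_range_succ, Finset.sum_eq_zero, zero_add, div_self (pow_ne_zero _ hz), mul_one]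
    intro l hl
    rw [h0 l (Finset.mem_range.1 hl), Complex.ofReal_zero, zero_mul]
  rw [h1, h3]
  simp only [h2, Complex.ofReal_sum, Complex.ofReal_mul, Finset.sum_mul]
  rw [Finset.sum_comm, Finset.mul_sum, ← Finset.sum_sub_distrib]
  refine Finset.sum_congr rfl fun i hi => ?_
  have hi' := Finset.mem_range.1 hi
  rw [pow_mul_momentSum_sub s (by omega) hz, Finset.range_eq_Ico,
    ← Finset.sum_Ico_consecutive _ (Nat.zero_le (m + 1)) (by omega : m + 1 ≤ N - i),
    ← Finset.range_eq_Ico, mul_add, mul_add, Finset.mul_sum, Finset.mul_sum, Finset.mul_sum,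
    Finset.mul_sum, Finset.mul_sum]
  have e1 : ∑ l ∈ Finset.range (m + 1), z ^ (m + 1) *
      ((P.coeff i : ℂ) * ((s (i + l) : ℂ) / z ^ (l + 1))) =
      ∑ l ∈ Finset.range (m + 1), (P.coeff i : ℂ) * (s (i + l) : ℂ) *
        (z ^ (m + 1) / z ^ (l + 1)) := Finset.sum_congr rfl fun l _ => by ring
  rw [e1, add_sub_cancel_left]
  exact Finset.sum_congr rfl fun l _ => by ring

namespace IsFirstKind

variable {s : ℕ → ℝ} {n : ℕ} {P : ℕ → ℝ[X]}

/-- P_n is orthogonal to P_n - lc · X^n, which has lower degree, and has norm one. -/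
theorem realMoment_mul_X_pow (hP : IsFirstKind s n P) :
    realMoment s (P n * X ^ n) = (P n).leadingCoeff⁻¹ := by
  have h1 := hP.realMoment_mul le_rfl (Nat.le_succ n)
  have hne := hP.ne_zero (Nat.le_succ n)
  have hlc := (hP.leadingCoeff_pos n (Nat.le_succ n)).ne'
  have h2 : realMoment s ((P n - (P n).leadingCoeff • X ^ n) * P n) = 0 := by
    refine hP.realMoment_mul_of_degree_lt (Nat.le_succ n) ?_
    rw [← hP.degree_eq (Nat.le_succ n)]
    refine degree_sub_lt_left ?_ hne ?_
    · rw [degree_smul_of_smul_regular _ (IsSMulRegular.of_ne_zero hlc), degree_X_pow,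
        hP.degree_eq (Nat.le_succ n)]
    · rw [leadingCoeff_smul_of_smul_regular _ (IsSMulRegular.of_ne_zero hlc),
        leadingCoeff_X_pow, smul_eq_mul, mul_one]
  rw [sub_mul, map_sub, h1, if_pos rfl, smul_mul_assoc, map_smul, smul_eq_mul, mul_comm (X ^ n)]
    at h2
  field_simp
  linarith

/-- The asymptotics at `∞` of the four coefficient functions of the Nevanlinna formula. -/
theorem numerator_isBigO (hP : IsFirstKind s n P) :
    (fun z => z ^ (n + 1) * (firstKind (P n) z * momentSum s (2 * n + 2) z -
      secondKind s (P n) z) - ((P n).leadingCoeff⁻¹ : ℝ))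
      =O[Bornology.cobounded ℂ] fun z => z⁻¹ := by
  rw [← hP.realMoment_mul_X_pow]
  refine pow_mul_firstKind_momentSum_sub_isBigO (hP.natDegree_eq n (Nat.le_succ n)).le (by omega)
    fun l hl => ?_
  rw [mul_comm]
  exact hP.realMoment_mul_of_degree_lt (Nat.le_succ n) (by rw [degree_X_pow]; exact_mod_cast hl)

/-- P_{n+1} is orthogonal to X^n too, so the constant term vanishes. The degree n + 1 with m = n
needs exactly the 2n + 2 given moments. -/
theorem numerator_succ_isBigO (hP : IsFirstKind s n P) :
    (fun z => z ^ (n + 1) * (firstKind (P (n + 1)) z * momentSum s (2 * n + 2) z -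
      secondKind s (P (n + 1)) z)) =O[Bornology.cobounded ℂ] fun z => z⁻¹ := by
  have h0 : ∀ l < n + 1, realMoment s (P (n + 1) * X ^ l) = 0 := fun l hl => by
    rw [mul_comm]
    exact hP.realMoment_mul_of_degree_lt le_rfl (by rw [degree_X_pow]; exact_mod_cast hl)
  have h := pow_mul_firstKind_momentSum_sub_isBigO (N := 2 * n + 2)
    (hP.natDegree_eq (n + 1) le_rfl).le (by omega) fun l hl => h0 l (Nat.lt_succ_of_lt hl)
  rw [h0 n (Nat.lt_succ_self n)] at h
  simpa using h

theorem denominator_isBigO (hP : IsFirstKind s n P) :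
    (fun z => firstKind (P n) z / z ^ (n + 1)) =O[Bornology.cobounded ℂ] fun z => z⁻¹ := by
  have hdeg := hP.natDegree_eq n (Nat.le_succ n)
  have h := firstKind_div_pow_sub_isBigO (P := P n) (k := n + 1) (by omega)
  rw [coeff_eq_zero_of_natDegree_lt (by omega)] at h
  simpa using h

theorem denominator_succ_isBigO (hP : IsFirstKind s n P) :
    (fun z => firstKind (P (n + 1)) z / z ^ (n + 1) - ((P (n + 1)).leadingCoeff : ℂ))
      =O[Bornology.cobounded ℂ] fun z => z⁻¹ := by
  have hdeg := hP.natDegree_eq (n + 1) le_rfl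
  have h := firstKind_div_pow_sub_isBigO hdeg.le
  have e : (P (n + 1)).leadingCoeff = (P (n + 1)).coeff (n + 1) := by rw [leadingCoeff, hdeg]
  rwa [e]

theorem scaledRemainder_eq (s : ℕ → ℝ) (n : ℕ) (φ : ℂ → ℂ) (z : ℂ) :
    scaledRemainder s (2 * n + 1) φ z =
      z ^ (n + 1) * (z ^ (n + 1) * (φ z + momentSum s (2 * n + 2) z)) := by
  rw [scaledRemainder, momentSum]
  ring

/-- The relation between the scaled remainder and the parameter. -/
theorem scaledRemainder_mul (s : ℕ → ℝ) (P : ℕ → ℝ[X]) (n : ℕ) {φ : ℂ → ℂ} {z t : ℂ} (hz : z ≠ 0)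
    (h : recSol s P (φ z) 1 z n * t + recSol s P (φ z) 1 z (n + 1) = 0) :
    scaledRemainder s (2 * n + 1) φ z *
        (firstKind (P n) z / z ^ (n + 1) * t + firstKind (P (n + 1)) z / z ^ (n + 1)) =
      z ^ (n + 1) * (firstKind (P n) z * momentSum s (2 * n + 2) z - secondKind s (P n) z) * t +
      z ^ (n + 1) * (firstKind (P (n + 1)) z * momentSum s (2 * n + 2) z -
        secondKind s (P (n + 1)) z) := by
  rw [scaledRemainder_eq]
  simp only [recSol] at h
  have hk : z ^ (n + 1) ≠ 0 := pow_ne_zero _ hz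
  field_simp
  linear_combination h

theorem recSol_eq (s : ℕ → ℝ) (P : ℕ → ℝ[X]) (n k : ℕ) (φ : ℂ → ℂ) {z : ℂ} (hz : z ≠ 0) :
    z ^ (n + 1) * recSol s P (φ z) 1 z k =
      firstKind (P k) z / z ^ (n + 1) * scaledRemainder s (2 * n + 1) φ z -
      z ^ (n + 1) * (firstKind (P k) z * momentSum s (2 * n + 2) z - secondKind s (P k) z) := by
  rw [scaledRemainder_eq, recSol]
  have hk : z ^ (n + 1) ≠ 0 := pow_ne_zero _ hz
  field_simp
  ring

theorem tendsto_of_sub_isBigO {f : ℂ → ℂ} {a : ℂ} {l : Filter ℂ} (hl : l ≤ Bornology.cobounded ℂ)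
    (h : (fun z => f z - a) =O[Bornology.cobounded ℂ] fun z => z⁻¹) : Tendsto f l (nhds a) :=
  tendsto_sub_nhds_zero_iff.1 ((h.trans_tendsto tendsto_inv₀_cobounded).mono_left hl)

/-- In `scaledRemainder_mul` the factor of the remainder tends to the leading coefficient of
P_{n+1}, which is nonzero, and the right side tends to 0. -/
theorem tendsto_scaledRemainder (hP : IsFirstKind s n P) {l : Filter ℂ}
    (hl : l ≤ Bornology.cobounded ℂ) {φ τ : ℂ → ℂ} (hτ : Tendsto τ l (nhds 0))
    (h : ∀ᶠ z in l, recSol s P (φ z) 1 z n * τ z + recSol s P (φ z) 1 z (n + 1) = 0) :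
    Tendsto (scaledRemainder s (2 * n + 1) φ) l (nhds 0) := by
  have hA := tendsto_of_sub_isBigO hl hP.numerator_isBigO
  have hB := (hP.numerator_succ_isBigO.trans_tendsto tendsto_inv₀_cobounded).mono_left hl
  have hd0 := (hP.denominator_isBigO.trans_tendsto tendsto_inv₀_cobounded).mono_left hl
  have hd1 := tendsto_of_sub_isBigO hl hP.denominator_succ_isBigO
  have hc : ((P (n + 1)).leadingCoeff : ℂ) ≠ 0 := by
    exact_mod_cast (hP.leadingCoeff_pos (n + 1) le_rfl).ne'
  have hden := (hd0.mul hτ).add hd1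
  rw [zero_mul, zero_add] at hden
  have hlim := ((hA.mul hτ).add hB).div hden hc
  rw [mul_zero, zero_add, zero_div] at hlim
  refine hlim.congr' ?_
  filter_upwards [h, hl (Bornology.eventually_ne_cobounded (0 : ℂ)), hden.eventually_ne hc]
    with z hz hz0 hne
  rw [Pi.div_apply, div_eq_iff hne, scaledRemainder_mul s P n hz0 hz]

/-- By `recSol_eq`, z^{n+1} c_{n+1} → 0 while z^{n+1} c_n tends to minus the inverse of the leading
coefficient of P_n. -/
theorem tendsto_parameter (hP : IsFirstKind s n P) {l : Filter ℂ}
    (hl : l ≤ Bornology.cobounded ℂ) {φ : ℂ → ℂ}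
    (hφ : Tendsto (scaledRemainder s (2 * n + 1) φ) l (nhds 0)) :
    Tendsto (fun z => -(recSol s P (φ z) 1 z (n + 1) / recSol s P (φ z) 1 z n)) l (nhds 0) := by
  have hA := tendsto_of_sub_isBigO hl hP.numerator_isBigO
  have hB := (hP.numerator_succ_isBigO.trans_tendsto tendsto_inv₀_cobounded).mono_left hl
  have hd0 := (hP.denominator_isBigO.trans_tendsto tendsto_inv₀_cobounded).mono_left hl
  have hd1 := tendsto_of_sub_isBigO hl hP.denominator_succ_isBigO
  have hc : (((P n).leadingCoeff⁻¹ : ℝ) : ℂ) ≠ 0 := by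
    exact_mod_cast (inv_pos.2 (hP.leadingCoeff_pos n (Nat.le_succ n))).ne'
  have h1 := (hd1.mul hφ).sub hB
  have h0 := (hd0.mul hφ).sub hA
  rw [mul_zero, sub_zero] at h1
  rw [mul_zero, zero_sub] at h0
  have hlim := (h1.div h0 (neg_ne_zero.2 hc)).neg
  rw [zero_div, neg_zero] at hlim
  refine hlim.congr' ?_
  filter_upwards [hl (Bornology.eventually_ne_cobounded (0 : ℂ))] with z hz0
  rw [Pi.div_apply, ← recSol_eq s P n _ φ hz0, ← recSol_eq s P n _ φ hz0,
    mul_div_mul_left _ _ (pow_ne_zero _ hz0)]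

end IsFirstKind
end Asymptotics

/-! ### The integral condition and the moment of order 2n + 1. -/

section Kac

theorem setIntegral_sq_div_sq_add_sq {t η : ℝ} (ht : t ≠ 0) :
    IntegrableOn (fun y : ℝ => t ^ 2 / (t ^ 2 + y ^ 2)) (Set.Ioi η) ∧
      ∫ y in Set.Ioi η, t ^ 2 / (t ^ 2 + y ^ 2) =
        |t| * (Real.pi / 2 - Real.arctan (η / |t|)) := by
  have ha : 0 < |t| := abs_pos.2 ht
  have hderiv : ∀ y ∈ Set.Ici η, HasDerivAt (fun y : ℝ => |t| * Real.arctan (y / |t|))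
      (t ^ 2 / (t ^ 2 + y ^ 2)) y := by
    intro y _
    have h := (((hasDerivAt_id y).div_const |t|).arctan).const_mul |t|
    refine h.congr_deriv ?_
    rw [← sq_abs t, id]
    field_simp
  have hnn : ∀ y ∈ Set.Ioi η, 0 ≤ t ^ 2 / (t ^ 2 + y ^ 2) := fun y _ => by positivity
  have hlim : Tendsto (fun y : ℝ => |t| * Real.arctan (y / |t|)) atTop
      (nhds (|t| * (Real.pi / 2))) :=
    ((Real.tendsto_arctan_atTop.mono_right nhdsWithin_le_nhds).comp
      (tendsto_id.atTop_div_const ha)).const_mul _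
  refine ⟨integrableOn_Ioi_deriv_of_nonneg' hderiv hnn hlim, ?_⟩
  rw [integral_Ioi_of_hasDerivAt_of_nonneg' hderiv hnn hlim]
  ring

theorem setLIntegral_pow_div_sq_add_sq {t η : ℝ} (k : ℕ) :
    ∫⁻ y in Set.Ioi η, ENNReal.ofReal (t ^ (2 * k + 2) / (t ^ 2 + y ^ 2)) =
      ENNReal.ofReal (t ^ (2 * k) * (|t| * (Real.pi / 2 - Real.arctan (η / |t|)))) := by
  have hk : 0 ≤ t ^ (2 * k) := by rw [pow_mul]; positivity
  rcases eq_or_ne t 0 with rfl | ht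
  · simp
  · obtain ⟨h1, h2⟩ := setIntegral_sq_div_sq_add_sq (η := η) ht
    rw [← h2, ← integral_const_mul, ofReal_integral_eq_lintegral_ofReal (h1.const_mul _)
      (ae_of_all _ fun y => by positivity)]
    refine lintegral_congr fun y => ?_
    rw [pow_add, mul_div_assoc]

theorem integrable_pow_div_sq_add_sq {μ : Measure ℝ} {k : ℕ}
    (hint : Integrable (fun t : ℝ => t ^ (2 * k)) μ) (y : ℝ) :
    Integrable (fun t : ℝ => t ^ (2 * k + 2) / (t ^ 2 + y ^ 2)) μ := by
  refine hint.mono' (Measurable.aestronglyMeasurable (by fun_prop)) (ae_of_all _ fun t => ?_)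
  have h0 : 0 ≤ t ^ (2 * k) := by rw [pow_mul]; positivity
  have h1 : 0 ≤ t ^ 2 / (t ^ 2 + y ^ 2) := by positivity
  rw [pow_add, mul_div_assoc, Real.norm_of_nonneg (mul_nonneg h0 h1)]
  exact mul_le_of_le_one_right h0
    (div_le_one_of_le₀ (by nlinarith [sq_nonneg y]) (by positivity))

/-- The Kac condition: `∫ t^{2k+2} / (t² + y²) dμ(t)` is integrable in `y` at infinity if and only
if `t^{2k+1}` is integrable. -/
theorem integrableOn_integral_pow_div_iff {μ : Measure ℝ} [IsFiniteMeasure μ] {k : ℕ}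
    (hint : Integrable (fun t : ℝ => t ^ (2 * k)) μ) {η : ℝ} (hη : 0 < η) :
    IntegrableOn (fun y : ℝ => ∫ t : ℝ, t ^ (2 * k + 2) / (t ^ 2 + y ^ 2) ∂μ) (Set.Ioi η) ↔
      Integrable (fun t : ℝ => t ^ (2 * k + 1)) μ := by
  have hk : ∀ t : ℝ, 0 ≤ t ^ (2 * k) := fun t => by rw [pow_mul]; positivity
  have hf0 : ∀ y t : ℝ, 0 ≤ t ^ (2 * k + 2) / (t ^ 2 + y ^ 2) := fun y t => by
    rw [pow_add, mul_div_assoc]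
    have := hk t
    positivity
  have hmeas : Measurable (Function.uncurry fun y t : ℝ => t ^ (2 * k + 2) / (t ^ 2 + y ^ 2)) := by
    unfold Function.uncurry
    fun_prop
  have hF : StronglyMeasurable fun y : ℝ => ∫ t : ℝ, t ^ (2 * k + 2) / (t ^ 2 + y ^ 2) ∂μ :=
    hmeas.stronglyMeasurable.integral_prod_right
  have h1 : IntegrableOn (fun y : ℝ => ∫ t : ℝ, t ^ (2 * k + 2) / (t ^ 2 + y ^ 2) ∂μ)
      (Set.Ioi η) ↔ ∫⁻ t, ENNReal.ofReal
        (t ^ (2 * k) * (|t| * (Real.pi / 2 - Real.arctan (η / |t|)))) ∂μ < ⊤ := by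
    -- Tonelli in [0, ∞], so integrability of the odd power need not be known beforehand.
    have e : ∫⁻ y in Set.Ioi η, ENNReal.ofReal
        (∫ t : ℝ, t ^ (2 * k + 2) / (t ^ 2 + y ^ 2) ∂μ) = ∫⁻ t, ENNReal.ofReal
        (t ^ (2 * k) * (|t| * (Real.pi / 2 - Real.arctan (η / |t|)))) ∂μ := by
      simp only [← setLIntegral_pow_div_sq_add_sq]
      rw [← lintegral_lintegral_swap hmeas.ennreal_ofReal.aemeasurable]
      exact lintegral_congr fun y => ofReal_integral_eq_lintegral_ofReal
        (integrable_pow_div_sq_add_sq hint y) (ae_of_all _ (hf0 y))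
    rw [← e, IntegrableOn, Integrable, hasFiniteIntegral_iff_ofReal
      (ae_of_all _ fun y => integral_nonneg (hf0 y))]
    exact and_iff_right hF.aestronglyMeasurable
  have harc : ∀ t : ℝ, 0 ≤ Real.arctan (η / |t|) := fun t => Real.arctan_nonneg.2 (by positivity)
  have harc' : ∀ t : ℝ, 0 ≤ Real.pi / 2 - Real.arctan (η / |t|) := fun t =>
    sub_nonneg.2 (Real.arctan_lt_pi_div_two _).le
  have hg0 : ∀ t : ℝ, 0 ≤ t ^ (2 * k) * (|t| * (Real.pi / 2 - Real.arctan (η / |t|))) := fun t =>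
    mul_nonneg (hk t) (mul_nonneg (abs_nonneg t) (harc' t))
  have hgm : Measurable fun t : ℝ =>
      t ^ (2 * k) * (|t| * (Real.pi / 2 - Real.arctan (η / |t|))) := by fun_prop
  have hnorm : ∀ t : ℝ, ‖t ^ (2 * k + 1)‖ = t ^ (2 * k) * |t| := fun t => by
    rw [pow_succ, norm_mul, Real.norm_of_nonneg (hk t), Real.norm_eq_abs]
  have h2 : ∫⁻ t, ENNReal.ofReal
      (t ^ (2 * k) * (|t| * (Real.pi / 2 - Real.arctan (η / |t|)))) ∂μ < ⊤ ↔
      Integrable (fun t : ℝ => t ^ (2 * k) * (|t| * (Real.pi / 2 - Real.arctan (η / |t|)))) μ := by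
    rw [Integrable, hasFiniteIntegral_iff_ofReal (ae_of_all _ hg0)]
    exact (and_iff_right hgm.aestronglyMeasurable).symm
  rw [h1, h2]
  constructor
  -- For |t| ≥ η the weight π/2 - arctan(η/|t|) is at least π/4, whence the factor 4/π; for |t| ≤ η
  -- the power is bounded and μ is finite.
  · intro h
    refine ((integrable_const (η ^ (2 * k) * η)).add (h.const_mul (4 / Real.pi))).mono'
      (by fun_prop) (ae_of_all _ fun t => ?_)
    rw [hnorm, Pi.add_apply]
    have h4 : 0 ≤ 4 / Real.pi := by positivity
    rcases le_total |t| η with hle | hle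
    · have h5 : t ^ (2 * k) ≤ η ^ (2 * k) := by
        rw [← (even_two_mul k).pow_abs]
        exact pow_le_pow_left₀ (abs_nonneg t) hle _
      have h6 := mul_le_mul h5 hle (abs_nonneg t) (by positivity)
      have h7 := mul_nonneg h4 (hg0 t)
      linarith
    · have hpos : 0 < |t| := hη.trans_le hle
      have h5 : Real.arctan (η / |t|) ≤ Real.pi / 4 := by
        rw [← Real.arctan_one]
        exact Real.arctan_strictMono.monotone ((div_le_one hpos).2 hle)
      have h6 : 1 ≤ 4 / Real.pi * (Real.pi / 2 - Real.arctan (η / |t|)) := by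
        have h8 : 4 / Real.pi * (Real.pi / 4) = 1 := by
          have := Real.pi_ne_zero
          field_simp
        rw [← h8]
        exact mul_le_mul_of_nonneg_left (by linarith) h4
      have h7 : 0 ≤ η ^ (2 * k) * η := by positivity
      have h9 := mul_le_mul_of_nonneg_left h6 (mul_nonneg (hk t) (abs_nonneg t))
      calc t ^ (2 * k) * |t| = t ^ (2 * k) * |t| * 1 := (mul_one _).symm
        _ ≤ t ^ (2 * k) * |t| * (4 / Real.pi * (Real.pi / 2 - Real.arctan (η / |t|))) := h9
        _ = 4 / Real.pi * (t ^ (2 * k) * (|t| * (Real.pi / 2 - Real.arctan (η / |t|)))) := by ring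
        _ ≤ _ := le_add_of_nonneg_left h7
  · intro h
    refine (h.norm.mul_const (Real.pi / 2)).mono' hgm.aestronglyMeasurable
      (ae_of_all _ fun t => ?_)
    rw [Real.norm_of_nonneg (hg0 t), hnorm, mul_assoc]
    exact mul_le_mul_of_nonneg_left
      (mul_le_mul_of_nonneg_left (by linarith [harc t]) (abs_nonneg t)) (hk t)

namespace IsFirstKind

variable {s : ℕ → ℝ} {n : ℕ} {P : ℕ → ℝ[X]}

/-- A sharper form of the limit. The constant in front of τ is real and positive, so imaginary parts
can be compared, and the error O(1/z) becomes integrable along the axis after division by y. -/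
theorem scaledRemainder_sub_isBigO (hP : IsFirstKind s n P) {l : Filter ℂ}
    (hl : l ≤ Bornology.cobounded ℂ) {φ τ : ℂ → ℂ} (hτ : Tendsto τ l (nhds 0))
    (h : ∀ᶠ z in l, recSol s P (φ z) 1 z n * τ z + recSol s P (φ z) 1 z (n + 1) = 0) :
    (fun z => scaledRemainder s (2 * n + 1) φ z -
      ((P n).leadingCoeff⁻¹ / (P (n + 1)).leadingCoeff : ℝ) * τ z) =O[l] fun z => z⁻¹ := by
  have hc : ((P (n + 1)).leadingCoeff : ℂ) ≠ 0 := by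
    exact_mod_cast (hP.leadingCoeff_pos (n + 1) le_rfl).ne'
  set c : ℂ := ((P (n + 1)).leadingCoeff : ℂ)
  set C : ℂ := ((((P n).leadingCoeff⁻¹ / (P (n + 1)).leadingCoeff : ℝ)) : ℂ)
  have hC : (((P n).leadingCoeff⁻¹ : ℝ) : ℂ) = C * c := by
    simp only [C]
    rw [Complex.ofReal_div, div_mul_cancel₀ _ hc]
  have hA := hP.numerator_isBigO.mono hl
  have hB := hP.numerator_succ_isBigO.mono hl
  have hd0 := hP.denominator_isBigO.mono hl
  have hd1 := hP.denominator_succ_isBigO.mono hl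
  have hτ1 : τ =O[l] fun _ => (1 : ℂ) := hτ.isBigO_one ℂ
  have hden := (((hd0.trans_tendsto (tendsto_inv₀_cobounded.mono_left hl)).mul hτ)).add
    (tendsto_of_sub_isBigO hl hP.denominator_succ_isBigO)
  rw [zero_mul, zero_add] at hden
  have hinv := (hden.inv₀ hc).isBigO_one ℂ
  have hd0τ := hd0.mul hτ1
  simp only [mul_one] at hd0τ
  -- Subtracting the constant times the denominator replaces the coefficient of τ by the difference
  -- of two functions with the same limit, which is O(1/z).
  have hnum := (((hA.sub ((hd0τ.add hd1).const_mul_left C)).mul hτ1))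
  simp only [mul_one] at hnum
  have hall := (hnum.add hB).mul hinv
  simp only [mul_one] at hall
  refine hall.congr' ?_ EventuallyEq.rfl
  filter_upwards [h, hl (Bornology.eventually_ne_cobounded (0 : ℂ)), hden.eventually_ne hc]
    with z hz hz0 hne
  have h1 := scaledRemainder_mul s P n hz0 hz
  rw [← div_eq_mul_inv, div_eq_iff hne, hC]
  linear_combination -h1

/-- Take imaginary parts on the axis and divide by y. The number s_{2n+1} is real and drops out, so
only the moments up to 2n are needed. -/
theorem integral_sub_isBigO (hP : IsFirstKind s n P) {μ : Measure ℝ} [IsFiniteMeasure μ]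
    (hμ : IsMomentSolution s (2 * n) μ) {τ : ℂ → ℂ} (hτ : CondO τ)
    (h : ∀ z : ℂ, z.im ≠ 0 → recSol s P (stieltjes μ z) 1 z n * τ z +
      recSol s P (stieltjes μ z) 1 z (n + 1) = 0) :
    (fun y : ℝ => (∫ t : ℝ, t ^ (2 * n + 2) / (t ^ 2 + y ^ 2) ∂μ) -
      (P n).leadingCoeff⁻¹ / (P (n + 1)).leadingCoeff * ((τ (Complex.I * y)).im / y))
      =O[atTop] fun y : ℝ => (y ^ 2)⁻¹ := by
  have hδ : 0 < Real.pi / 4 := by have := Real.pi_pos; linarith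
  have h1 := (hP.scaledRemainder_sub_isBigO (inf_le_left : sectorAtInfty (Real.pi / 4) ≤ _)
    ((isLittleO_one_iff ℂ).1 (hτ _ hδ)) (by
      filter_upwards [eventually_sectorAtInfty hδ] with z hz using h z hz.2.1.ne')).comp_tendsto
    tendsto_I_mul_sectorAtInfty
  have h2 : (fun y : ℝ => (scaledRemainder s (2 * n + 1) (stieltjes μ) (Complex.I * y) -
      ((P n).leadingCoeff⁻¹ / (P (n + 1)).leadingCoeff : ℝ) * τ (Complex.I * y)).im)
      =O[atTop] fun y : ℝ => y⁻¹ := by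
    refine ((isBigO_of_le _ fun y => ?_).trans h1).trans (isBigO_of_le _ fun y => ?_)
    · exact Complex.abs_im_le_norm _
    · simp
  refine ((h2.mul (isBigO_refl (fun y : ℝ => y⁻¹) atTop))).congr' ?_ ?_
  · filter_upwards [eventually_gt_atTop 0] with y hy
    have him : (Complex.I * (y : ℂ)).im ≠ 0 := by simpa using hy.ne'
    have hint : Integrable (fun t : ℝ => t ^ (2 * n) ) μ := (hμ (2 * n) le_rfl).1
    have h3 := integral_pow_div_I_mul_re (μ := μ) (m := 2 * n + 1) (y := y)
      (integrable_pow_succ_div_ofReal_sub hint him)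
    rw [scaledRemainder_stieltjes (fun j hj => hμ j (by omega)) him, ← h3]
    set J := ∫ t : ℝ, (t : ℂ) ^ (2 * n + 1) / ((t : ℂ) - Complex.I * y) ∂μ
    rw [Complex.sub_im, Complex.im_ofReal_mul]
    have h4 : ((s (2 * n + 1) : ℂ) + Complex.I * y * J).im = y * J.re := by simp
    rw [h4]
    field_simp
  · filter_upwards with y
    rw [← mul_inv, sq]

/-- The parameter satisfies the Kac condition if and only if the moment of order `2n + 1`
exists. -/
theorem kac_iff (hP : IsFirstKind s n P) {μ : Measure ℝ} [IsFiniteMeasure μ]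
    (hμ : IsMomentSolution s (2 * n) μ) {τ : ℂ → ℂ} (hτN : IsNevanlinna τ) (hτ : CondO τ)
    (h : ∀ z : ℂ, z.im ≠ 0 → recSol s P (stieltjes μ z) 1 z n * τ z +
      recSol s P (stieltjes μ z) 1 z (n + 1) = 0) :
    (∃ η : ℝ, 0 < η ∧
      IntegrableOn (fun y : ℝ => |(τ (Complex.I * y)).im| / y) (Set.Ioi η)) ↔
    Integrable (fun t : ℝ => t ^ (2 * n + 1)) μ := by
  have hint : Integrable (fun t : ℝ => t ^ (2 * n) ) μ := (hμ (2 * n) le_rfl).1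
  set C : ℝ := (P n).leadingCoeff⁻¹ / (P (n + 1)).leadingCoeff
  have hC : C ≠ 0 := (div_pos (inv_pos.2 (hP.leadingCoeff_pos n (Nat.le_succ n)))
    (hP.leadingCoeff_pos (n + 1) le_rfl)).ne'
  obtain ⟨K, hK⟩ := (hP.integral_sub_isBigO hμ hτ h).bound
  obtain ⟨y₀, hy₀⟩ := eventually_atTop.1 hK
  have hcont : ∀ η : ℝ, 0 < η →
      ContinuousOn (fun y : ℝ => (τ (Complex.I * y)).im / y) (Set.Ioi η) := by
    intro η hη
    refine ContinuousOn.div (Complex.continuous_im.comp_continuousOn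
      (hτN.holo.continuousOn.comp (by fun_prop) fun y hy => ?_)) continuousOn_id
      fun y hy => (hη.trans hy).ne'
    have : 0 < y := hη.trans hy
    simpa using this.ne'
  have hFm : StronglyMeasurable fun y : ℝ =>
      ∫ t : ℝ, t ^ (2 * n + 2) / (t ^ 2 + y ^ 2) ∂μ := by
    refine Measurable.stronglyMeasurable ?_ |>.integral_prod_right
    unfold Function.uncurry
    fun_prop
  have habs : ∀ η : ℝ, 0 < η →
      (IntegrableOn (fun y : ℝ => |(τ (Complex.I * y)).im| / y) (Set.Ioi η) ↔
        IntegrableOn (fun y : ℝ => (τ (Complex.I * y)).im / y) (Set.Ioi η)) := by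
    intro η hη
    refine integrableOn_congr_fun (fun y hy => ?_) measurableSet_Ioi
    have hy0 : 0 < y := hη.trans hy
    rw [abs_of_nonneg (hτN.im_nonneg _ (by simpa using hy0))]
  -- The difference is O(y^{-2}), so beyond y₀ the two functions are integrable together.
  have hE : ∀ η : ℝ, 0 < η → y₀ ≤ η → IntegrableOn (fun y : ℝ =>
      (∫ t : ℝ, t ^ (2 * n + 2) / (t ^ 2 + y ^ 2) ∂μ) - C * ((τ (Complex.I * y)).im / y))
      (Set.Ioi η) := by
    intro η hη hle
    have hr : IntegrableOn (fun y : ℝ => K * y ^ (-2 : ℝ)) (Set.Ioi η) :=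
      (integrableOn_Ioi_rpow_of_lt (by norm_num) hη).const_mul K
    refine hr.mono' (hFm.aestronglyMeasurable.sub
      (((hcont η hη).aestronglyMeasurable measurableSet_Ioi).const_mul C)) ?_
    refine (ae_restrict_iff' measurableSet_Ioi).2 (ae_of_all _ fun y hy => ?_)
    have hy0 : 0 < y := hη.trans hy
    refine (hy₀ y (hle.trans (le_of_lt hy))).trans (le_of_eq ?_)
    rw [Real.rpow_neg hy0.le, Real.rpow_two, Real.norm_of_nonneg (by positivity)]
  constructor
  · rintro ⟨η, hη, hI⟩
    have hη' : 0 < max η y₀ := hη.trans_le (le_max_left _ _)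
    rw [← integrableOn_integral_pow_div_iff hint hη']
    have h1 := ((habs η hη).1 hI).mono_set (Set.Ioi_subset_Ioi (le_max_left η y₀))
    refine ((hE _ hη' (le_max_right _ _)).add (h1.const_mul C)).congr (ae_of_all _ fun y => ?_)
    simp
  · intro hI
    have hη' : 0 < max 1 y₀ := one_pos.trans_le (le_max_left _ _)
    refine ⟨max 1 y₀, hη', (habs _ hη').2 ?_⟩
    have h1 := (integrableOn_integral_pow_div_iff hint hη').2 hI
    refine ((h1.sub (hE _ hη' (le_max_right _ _))).const_mul C⁻¹).congr (ae_of_all _ fun y => ?_)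
    simp [hC]

end IsFirstKind
end Kac

/-! ### Description of the solutions by the parameter. -/

section Parametrization

theorem IsNevanlinna.congr {f g : ℂ → ℂ} (hf : IsNevanlinna f)
    (h : ∀ z : ℂ, z.im ≠ 0 → g z = f z) : IsNevanlinna g where
  holo := hf.holo.congr fun z hz => h z hz
  symm z hz := by
    rw [h z hz, h _ (by simpa using hz), hf.symm z hz]
  im_nonneg z hz := by
    rw [h z hz.ne']
    exact hf.im_nonneg z hz

theorem IsInterpolationSolution.congr {s : ℕ → ℝ} {l : ℕ} {f g : ℂ → ℂ}
    (hf : IsInterpolationSolution s l f) (h : ∀ z : ℂ, z.im ≠ 0 → g z = f z) :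
    IsInterpolationSolution s l g where
  nevanlinna := hf.nevanlinna.congr h
  expansion δ hδ := by
    refine (hf.expansion δ hδ).congr' ?_ EventuallyEq.rfl
    filter_upwards [eventually_sectorAtInfty hδ] with z hz
    rw [h z hz.2.1.ne']

theorem condO_iff {τ : ℂ → ℂ} :
    CondO τ ↔ ∀ δ : ℝ, 0 < δ → Tendsto τ (sectorAtInfty δ) (nhds 0) :=
  forall₂_congr fun _ _ => isLittleO_one_iff ℂ

theorem CondO.ntLittleO_id {τ : ℂ → ℂ} (h : CondO τ) : NTLittleO τ fun z => z := by
  intro δ hδ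
  refine (h δ hδ).trans_isBigO (isBigO_iff.2 ⟨1, ?_⟩)
  have : ∀ᶠ z : ℂ in Bornology.cobounded ℂ, 1 ≤ ‖z‖ :=
    tendsto_norm_cobounded_atTop.eventually_ge_atTop 1
  filter_upwards [this.filter_mono (inf_le_left : sectorAtInfty δ ≤ _)] with z hz
  simpa using hz

theorem isNevanlinnaOne_zero : IsNevanlinnaOne fun _ => 0 where
  nevanlinna := ⟨differentiableOn_const 0, by simp, by simp⟩
  little_o _ _ := isLittleO_zero _ _
  integrable := ⟨1, one_pos, by simp⟩

theorem condO_zero : CondO fun _ => 0 := fun _ _ => isLittleO_zero _ _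

/-- The scaled remainder of a solution tends to `0` along the imaginary axis. -/
theorem IsInterpolationSolution.tendsto_axis {s : ℕ → ℝ} {l : ℕ} {φ : ℂ → ℂ}
    (h : IsInterpolationSolution s l φ) :
    Tendsto (fun y : ℝ => scaledRemainder s l φ (Complex.I * y)) atTop (nhds 0) :=
  ((ntLittleO_expansion_iff s l φ).1 h.expansion _
    (by have := Real.pi_pos; linarith : 0 < Real.pi / 4)).comp tendsto_I_mul_sectorAtInfty

namespace IsFirstKind

variable {s : ℕ → ℝ} {n : ℕ} {P : ℕ → ℝ[X]}

theorem isInterpolationSolution (hP : IsFirstKind s n P) (hS : (hankel s n).PosDef)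
    {τ φ : ℂ → ℂ} (hτ : IsNevanlinna τ) (hO : CondO τ)
    (h : ∀ z : ℂ, z.im ≠ 0 → φ z = nevFormula s P n τ z) :
    IsInterpolationSolution s (2 * n + 1) φ where
  nevanlinna := (hP.isNevanlinna_nevFormula hS hτ).congr h
  expansion := (ntLittleO_expansion_iff s (2 * n + 1) φ).2 fun δ hδ => by
    refine hP.tendsto_scaledRemainder inf_le_left (condO_iff.1 hO δ hδ) ?_
    filter_upwards [eventually_sectorAtInfty hδ] with z hz
    exact (eq_nevFormula_iff (hP.nevDenom_ne_zero hS hτ hz.2.1.ne')).1 (h z hz.2.1.ne')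

/-- The parameter is -c_{n+1} / c_n. The expansion of order 2n + 1 gives only the moments up to 2n,
which is enough for Bessel's inequality. -/
theorem exists_parameter (hP : IsFirstKind s n P) (hS : (hankel s n).PosDef) {μ : Measure ℝ}
    [IsFiniteMeasure μ] (h : IsInterpolationSolution s (2 * n + 1) (stieltjes μ)) :
    ∃ τ : ℂ → ℂ, IsNevanlinna τ ∧ CondO τ ∧
      ∀ z : ℂ, z.im ≠ 0 → stieltjes μ z = nevFormula s P n τ z := by
  have hμ : IsMomentSolution s (2 * n) μ :=
    isMomentSolution_of_tendsto (Nat.le_succ (2 * n)) h.tendsto_axis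
  have hN := hP.isNevanlinna_parameter hS hμ
  refine ⟨_, hN, condO_iff.2 fun δ hδ => hP.tendsto_parameter inf_le_left
    ((ntLittleO_expansion_iff _ _ _).1 h.expansion δ hδ), fun z hz => ?_⟩
  rw [eq_nevFormula_iff (hP.nevDenom_ne_zero hS hN hz)]
  have := hP.recSol_stieltjes_ne_zero hμ hz
  field_simp
  ring

theorem isInterpolationSolution_iff (hP : IsFirstKind s n P) (hS : (hankel s n).PosDef)
    (φ : ℂ → ℂ) : IsInterpolationSolution s (2 * n + 1) φ ↔
      ∃ τ : ℂ → ℂ, IsNevanlinna τ ∧ CondO τ ∧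
        ∀ z : ℂ, z.im ≠ 0 → φ z = nevFormula s P n τ z := by
  constructor
  · intro h
    obtain ⟨μ, hfin, hμ⟩ := h.exists_stieltjes
    obtain ⟨τ, hτ, hO, hform⟩ := hP.exists_parameter hS (h.congr fun z hz => (hμ z hz).symm)
    exact ⟨τ, hτ, hO, fun z hz => (hμ z hz).trans (hform z hz)⟩
  · rintro ⟨τ, hτ, hO, h⟩
    exact hP.isInterpolationSolution hS hτ hO h

/-- Among measures whose transform solves the interpolation problem, only integrability of t^{2n+1}
is at stake, and `kac_iff` expresses it through τ. The growth condition in N_{0,1} follows from (O).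
-/
theorem isMomentSolution_iff (hP : IsFirstKind s n P) (hS : (hankel s n).PosDef) (μ : Measure ℝ)
    [IsFiniteMeasure μ] : IsMomentSolution s (2 * n + 1) μ ↔
      ∃ τ : ℂ → ℂ, IsNevanlinnaOne τ ∧ CondO τ ∧
        ∀ z : ℂ, z.im ≠ 0 → stieltjes μ z = nevFormula s P n τ z := by
  constructor
  · intro h
    obtain ⟨τ, hτ, hO, hform⟩ := hP.exists_parameter hS h.isInterpolationSolution
    refine ⟨τ, ⟨hτ, hO.ntLittleO_id, ?_⟩, hO, hform⟩
    exact (hP.kac_iff (fun j hj => h j (by omega)) hτ hO fun z hz =>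
      (eq_nevFormula_iff (hP.nevDenom_ne_zero hS hτ hz)).1 (hform z hz)).2 (h _ le_rfl).1
  · rintro ⟨τ, hτ, hO, hform⟩
    have h := hP.isInterpolationSolution hS hτ.nevanlinna hO hform
    have hμ : IsMomentSolution s (2 * n) μ :=
      isMomentSolution_of_tendsto (Nat.le_succ (2 * n)) h.tendsto_axis
    have hint := (hP.kac_iff hμ hτ.nevanlinna hO fun z hz =>
      (eq_nevFormula_iff (hP.nevDenom_ne_zero hS hτ.nevanlinna hz)).1 (hform z hz)).1
        hτ.integrable
    -- Once the last moment exists, the expansion determines its value.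
    have heq := moment_eq_of_tendsto (fun j hj => hμ j (Nat.lt_succ_iff.1 hj)) hint h.tendsto_axis
    intro j hj
    rcases Nat.lt_or_eq_of_le hj with hj | rfl
    · exact hμ j (Nat.lt_succ_iff.1 hj)
    · exact ⟨hint, heq⟩

theorem exists_isMomentSolution (hP : IsFirstKind s n P) (hS : (hankel s n).PosDef) {τ : ℂ → ℂ}
    (hτ : IsNevanlinnaOne τ) (hO : CondO τ) :
    ∃ μ : Measure ℝ, IsMomentSolution s (2 * n + 1) μ ∧
      ∀ z : ℂ, z.im ≠ 0 → stieltjes μ z = nevFormula s P n τ z := by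
  have h := hP.isInterpolationSolution hS hτ.nevanlinna hO fun z _ => rfl
  obtain ⟨μ, hfin, hμ⟩ := h.exists_stieltjes
  have hform : ∀ z : ℂ, z.im ≠ 0 → stieltjes μ z = nevFormula s P n τ z :=
    fun z hz => (hμ z hz).symm
  exact ⟨μ, (hP.isMomentSolution_iff hS μ).2 ⟨τ, hτ, hO, hform⟩, hform⟩

end IsFirstKind
end Parametrization

end TruncatedHamburger

theorem corollary5p2 (n : ℕ) (s : ℕ → ℝ) (hS : (TruncatedHamburger.hankel s n).PosDef) :
    -- the moment problem is solvable
    (∃ μ : Measure ℝ, TruncatedHamburger.IsMomentSolution s (2 * n + 1) μ) ∧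
    -- the polynomials of the first kind exist
    (∃ P : ℕ → ℝ[X], TruncatedHamburger.IsFirstKind s n P) ∧
    ∀ P : ℕ → ℝ[X], TruncatedHamburger.IsFirstKind s n P →
      -- the denominator of the formula never vanishes off the real line
      (∀ τ : ℂ → ℂ, TruncatedHamburger.IsNevanlinna τ →
        ∀ z : ℂ, z.im ≠ 0 → TruncatedHamburger.nevDenom P n τ z ≠ 0) ∧
      -- distinct parameters give distinct functions
      (∀ τ₁ τ₂ : ℂ → ℂ, TruncatedHamburger.IsNevanlinna τ₁ → TruncatedHamburger.IsNevanlinna τ₂ →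
        (∀ z : ℂ, z.im ≠ 0 → TruncatedHamburger.nevFormula s P n τ₁ z =
          TruncatedHamburger.nevFormula s P n τ₂ z) →
        ∀ z : ℂ, z.im ≠ 0 → τ₁ z = τ₂ z) ∧
      -- the solutions of the moment problem
      (∀ μ : Measure ℝ, IsFiniteMeasure μ →
        (TruncatedHamburger.IsMomentSolution s (2 * n + 1) μ ↔
          ∃ τ : ℂ → ℂ, TruncatedHamburger.IsNevanlinnaOne τ ∧ TruncatedHamburger.CondO τ ∧
            ∀ z : ℂ, z.im ≠ 0 → TruncatedHamburger.stieltjes μ z =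
              TruncatedHamburger.nevFormula s P n τ z)) ∧
      (∀ τ : ℂ → ℂ, TruncatedHamburger.IsNevanlinnaOne τ → TruncatedHamburger.CondO τ →
        ∃ μ : Measure ℝ, TruncatedHamburger.IsMomentSolution s (2 * n + 1) μ ∧
          ∀ z : ℂ, z.im ≠ 0 → TruncatedHamburger.stieltjes μ z =
            TruncatedHamburger.nevFormula s P n τ z) ∧
      -- the solutions of the interpolation problem
      (∀ φ : ℂ → ℂ, TruncatedHamburger.IsInterpolationSolution s (2 * n + 1) φ ↔
        ∃ τ : ℂ → ℂ, TruncatedHamburger.IsNevanlinna τ ∧ TruncatedHamburger.CondO τ ∧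
          ∀ z : ℂ, z.im ≠ 0 → φ z = TruncatedHamburger.nevFormula s P n τ z) := by
  obtain ⟨P₀, hP₀⟩ := TruncatedHamburger.exists_isFirstKind hS
  -- Solvability comes from the parameter τ = 0.
  obtain ⟨μ₀, hμ₀, -⟩ := hP₀.exists_isMomentSolution hS TruncatedHamburger.isNevanlinnaOne_zero
    TruncatedHamburger.condO_zero
  refine ⟨⟨μ₀, hμ₀⟩, ⟨P₀, hP₀⟩, fun P hP => ⟨?_, ?_, ?_, ?_, ?_⟩⟩
  · exact fun τ hτ z hz => hP.nevDenom_ne_zero hS hτ hz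
  · exact fun τ₁ τ₂ h₁ h₂ h z hz => hP.nevFormula_injective hS h₁ h₂ hz (h z hz)
  · exact fun μ _ => hP.isMomentSolution_iff hS μ
  · exact fun τ hτ hO => hP.exists_isMomentSolution hS hτ hO
  · exact hP.isInterpolationSolution_iff hS
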